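/- Let $G=(V,E)$ be a finite graph (loops and parallel edges are allowed a priori), let $0\le k\le 2$, and let $\chi:V\to\mathcal C\cup\{\bullet\}$ be a $k$-colouring: $|\mathcal C|=k$, every colour of $\mathcal C$ is used, and vertices with $\chi(v)=\bullet$ are called uncoloured. Assume $n:=|V|\ge k+3$. Let $r:\mathcal C\to\mathbb R_{>0}$ and $p:V\to\mathbb R^3$ be a framework on the concentric spheres $r\mathbb S^2$, that is, $\|p(v)\|=r(c)$ if $\chi(v)=c\in\mathcal C$ and $\|p(v)\|=1$ if $v$ is uncoloured, and suppose that it is generic: every polynomial with rational coefficients that vanishes at the coordinates of $p$ and $r$ lies in the ideal generated by the polynomials $\|x_v\|^2-\rho_{\chi(v)}^2$ ($v$ coloured) and $\|x_v\|^2-1$ ($v$ uncoloured), where the $x_v$ are the variables for the points and the $\rho_c$ those for the radii. Let $$R(G,\chi,p)=\begin{pmatrix} R(G,p) & 0\\ S(G,p) & V(G,\chi,p)\end{pmatrix},$$ where $R(G,p)$ is the usual rigidity matrix in $\mathbb R^3$ (the row of an edge $ij$ has $p(i)-p(j)$ in the columns of $i$, $p(j)-p(i)$ in those of $j$, and zeros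 elsewhere), $S(G,p)$ is the $n\times 3n$ matrix whose row for $v$ has $p(v)$ in the columns of $v$ and zeros elsewhere, and $V(G,\chi,p)$ is the $n\times k$ matrix whose row for a coloured vertex $v$ has $1$ in the column of $\chi(v)$, all other entries being zero. Call $(G,\chi,p)$ isostatic if the rows of $R(G,\chi,p)$ are linearly independent and $\operatorname{rank}R(G,\chi,p)=3n-3+\min\{k,n-3\}$. Then $(G,\chi,p)$ is isostatic if and only if $G$ is simple and $f_2$-tight, that is, $|E|=2|V|-3+k$ and $|F|\le r_2(F)+k(F)$ for all $F\subseteq E$, where $r_2$ is the rank function of the generic 2-dimensional rigidity matroid ($r_2(F)$ is the maximum over all $q:V\to\mathbb R^2$ of the rank of the rows of $F$ in the rigidity matrix of $(G,q)$) and $k(F)$ is the number of colours that occur on the end-vertices of the edges in $F$. (The case $k=1$ with every vertex coloured is that of uniformly expanding spherical frameworks in $\mathbb R^3$.) -/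

import Mathlib

open scoped Graph

noncomputable section

namespace SphereRigidity

/-!
A finite graph, possibly with loops and parallel edges, is a `Graph α β` whose vertex set `V(G)`
and edge set `E(G)` are finite. A colouring is a map `χ : V(G) → Option C`, where `none` means
that a vertex is uncoloured; it is a `k`-colouring when every colour of `C` is used and `C` has
`k` elements.
-/

open Classical in
/-- The usual rigidity matrix of the framework `(G, p)` in `ℝᵐ`. In the row of an edge joining
`v` and `w`, the columns of `v` hold `p v - p w`, the columns of `w` hold `p w - p v`, and all the
other entries vanish; in particular the row of a loop is zero. (For a given edge `e` and end `v`
of `e`, the sum below has exactly one nontrivial summand, that of the other end of `e`.) -/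
def rigidityMatrix {α β : Type*} (G : Graph α β) [Fintype V(G)] {m : ℕ}
    (p : V(G) → EuclideanSpace ℝ (Fin m)) : Matrix E(G) (V(G) × Fin m) ℝ :=
  Matrix.of fun e x => ∑ w : V(G), if G.IsLink e x.1 w then p x.1 x.2 - p w x.2 else 0

/-- The rank function `r_d` of the `d`-dimensional generic rigidity matroid: the generic, that is,
the maximum, rank of the rows of `F` in the rigidity matrix of a framework `(G, q)` in `ℝᵈ`. -/
def genericRank (d : ℕ) {α β : Type*} (G : Graph α β) [Fintype V(G)] (F : Finset E(G)) : ℕ :=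
  ⨆ q : V(G) → EuclideanSpace ℝ (Fin d),
    ((rigidityMatrix G q).submatrix (Subtype.val : F → E(G)) id).rank

/-- The supremum defining `genericRank` is a maximum. -/
theorem bddAbove_genericRank (d : ℕ) {α β : Type*} (G : Graph α β) [Fintype V(G)]
    (F : Finset E(G)) :
    BddAbove (Set.range fun q : V(G) → EuclideanSpace ℝ (Fin d) =>
      ((rigidityMatrix G q).submatrix (Subtype.val : F → E(G)) id).rank) :=
  ⟨Fintype.card (V(G) × Fin d), by rintro _ ⟨q, rfl⟩; exact Matrix.rank_le_card_width _⟩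

/-- `k(F)`, the number of colours that occur on the vertices spanned by `F`. -/
def numColours {α β : Type*} (G : Graph α β) {C : Type*} (χ : V(G) → Option C)
    (F : Finset E(G)) : ℕ :=
  Set.ncard {c : C | ∃ e ∈ F, ∃ v : V(G), G.Inc e v ∧ χ v = some c}

/-- `G` is `f_d`-sparse for `f_d = r_d + k`: `|F| ≤ r_d(F) + k(F)` for all sets `F` of edges. -/
def IsSparse (d : ℕ) {α β : Type*} (G : Graph α β) [Fintype V(G)] {C : Type*}
    (χ : V(G) → Option C) : Prop :=
  ∀ F : Finset E(G), F.card ≤ genericRank d G F + numColours G χ F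

/-- `G` is `f_d`-tight: it is `f_d`-sparse and `|E| = d |V| - (d+1 choose 2) + k`. -/
def IsTight (d : ℕ) {α β : Type*} (G : Graph α β) [Fintype V(G)] [Fintype E(G)]
    {C : Type*} [Fintype C] (χ : V(G) → Option C) : Prop :=
  (Fintype.card E(G) : ℤ) =
      d * Fintype.card V(G) - ((d + 1).choose 2 : ℕ) + Fintype.card C ∧
    IsSparse d G χ

/-- `(G, χ, p)` is a framework on the concentric spheres `r 𝕊ᵈ ⊂ ℝᵈ⁺¹`: the radii are positive, a
vertex of colour `c` lies on the sphere of radius `r c`, an uncoloured one on the unit sphere. -/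
def IsFramework {d : ℕ} {α β : Type*} (G : Graph α β) {C : Type*} (χ : V(G) → Option C)
    (r : C → ℝ) (p : V(G) → EuclideanSpace ℝ (Fin (d + 1))) : Prop :=
  (∀ c, 0 < r c) ∧ ∀ v, ‖p v‖ = (χ v).elim 1 r

/-- The defining polynomial of the sphere of the vertex `v`, in variables for the coordinates of
all points and for the radii: `∑ᵢ X_{v,i}² - X_c²` if `v` has colour `c` and `∑ᵢ X_{v,i}² - 1` if
`v` is uncoloured. -/
def spherePolynomial (d : ℕ) {α β : Type*} (G : Graph α β) {C : Type*} (χ : V(G) → Option C)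
    (v : V(G)) : MvPolynomial ((V(G) × Fin (d + 1)) ⊕ C) ℚ :=
  ∑ i, MvPolynomial.X (Sum.inl (v, i)) ^ 2 -
    (χ v).elim 1 fun c => MvPolynomial.X (Sum.inr c) ^ 2

/-- `(G, χ, p)` is generic on `r 𝕊ᵈ`: every rational polynomial that vanishes at the coordinates
of `p` and `r` lies in the ideal generated by the defining polynomials of the spheres. -/
def IsGeneric {d : ℕ} {α β : Type*} (G : Graph α β) {C : Type*} (χ : V(G) → Option C)
    (r : C → ℝ) (p : V(G) → EuclideanSpace ℝ (Fin (d + 1))) : Prop :=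
  ∀ f : MvPolynomial ((V(G) × Fin (d + 1)) ⊕ C) ℚ,
    MvPolynomial.aeval (Sum.elim (fun x : V(G) × Fin (d + 1) => p x.1 x.2) r) f = 0 →
      f ∈ Ideal.span (Set.range (spherePolynomial d G χ))

open Classical in
/-- The block `S(G, p)`: the row of `v` holds `p v` in the columns of `v`. -/
def sphereBlock {d : ℕ} {α β : Type*} (G : Graph α β)
    (p : V(G) → EuclideanSpace ℝ (Fin (d + 1))) : Matrix V(G) (V(G) × Fin (d + 1)) ℝ :=
  Matrix.of fun v x => if x.1 = v then p v x.2 else 0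

open Classical in
/-- The block `V(G, χ, p)`: the row of a vertex of colour `c` holds `1` in the column of `c`. -/
def colourBlock {α β : Type*} (G : Graph α β) {C : Type*} (χ : V(G) → Option C) :
    Matrix V(G) C ℝ :=
  Matrix.of fun v c => if χ v = some c then 1 else 0

/-- The rigidity matrix `R(G, χ, p)`, of size `(|E| + n) × ((d + 1) n + k)`. -/
def sphereRigidityMatrix {d : ℕ} {α β : Type*} (G : Graph α β) [Fintype V(G)] {C : Type*}
    (χ : V(G) → Option C) (p : V(G) → EuclideanSpace ℝ (Fin (d + 1))) :
    Matrix (E(G) ⊕ V(G)) ((V(G) × Fin (d + 1)) ⊕ C) ℝ :=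
  Matrix.fromBlocks (rigidityMatrix G p) 0 (sphereBlock G p) (colourBlock G χ)

/-- `(G, χ, p)` is independent: the rows of its rigidity matrix are linearly independent. -/
def IsIndependent {d : ℕ} {α β : Type*} (G : Graph α β) [Fintype V(G)] {C : Type*}
    (χ : V(G) → Option C) (p : V(G) → EuclideanSpace ℝ (Fin (d + 1))) : Prop :=
  LinearIndependent ℝ (sphereRigidityMatrix G χ p).row

/-- `(G, χ, p)` is infinitesimally rigid: the rank of its rigidity matrix equals
`(d+1) n - (d+1 choose 2) + min {k, n - (d+1)}`. -/
def IsInfinitesimallyRigid {d : ℕ} {α β : Type*} (G : Graph α β) [Fintype V(G)] {C : Type*}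
    [Fintype C] (χ : V(G) → Option C) (p : V(G) → EuclideanSpace ℝ (Fin (d + 1))) : Prop :=
  ((sphereRigidityMatrix G χ p).rank : ℤ) =
    (d + 1) * Fintype.card V(G) - ((d + 1).choose 2 : ℕ) +
      min (Fintype.card C : ℤ) (Fintype.card V(G) - (d + 1))

/-- `(G, χ, p)` is isostatic: it is independent and infinitesimally rigid. -/
def IsIsostatic {d : ℕ} {α β : Type*} (G : Graph α β) [Fintype V(G)] {C : Type*}
    [Fintype C] (χ : V(G) → Option C) (p : V(G) → EuclideanSpace ℝ (Fin (d + 1))) : Prop :=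
  IsIndependent G χ p ∧ IsInfinitesimallyRigid G χ p

end SphereRigidity

end

/-! A row dependency of `R(G, χ, p)` amounts to a symmetric matrix `A`, supported on the diagonal
and the edges, with `A p = 0`. Its row sums are the coefficients of the sphere rows, so the columns
of `V(G, χ, p)` require the row sums over each colour class to add up to zero. Independence
therefore means that no nonzero stress has all its colour sums zero. Rescaling single points changes
stresses by a diagonal congruence, so the framework can be projected centrally to a plane, and the
stresses of `F` form a space of dimension `|F| - r_2(F)`. Sparsity becomes: no subgraph has more
independent stresses than colours.

Sparsity is necessary because in an independent framework the colour sums embed the stresses of a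
subgraph into a space with one coordinate for each of its colours.

Sufficiency (`colourStress_eq_bot`) is an induction on the number of edges. A minimal dependent
sparse graph `H` has a nowhere zero stress `A` with zero colour sums. It has at most two independent
stresses, so a count gives a vertex `v` of degree three. Moving `v` to a special point `∑ c w • p w`
of its sphere cannot destroy the dependency. Adding `c cᵀ` to a multiple of the resulting stress
clears the row of `v` and leaves a stress `N` on the other vertices, with known colour sums
(`exists_stress_of_dependent`).

If `v` or a neighbour `x` has colour `d`, moving `v` to the two points of its sphere on the line of
`x` produces a stress of `H - v` whose only nonzero colour sum is that of `d`. Together with `A` it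
spans all stresses, so any other colour sum vanishes identically; passing to antipodes shows that
stresses then vanish on all edges at that colour, a contradiction. If `v` and its neighbours are
uncoloured, moving `v` into the plane of two neighbours shows that each pair of neighbours is an
edge or is closed by a stress through an uncoloured subgraph. Substituting these into the stress of
the complete graph on `v` and its neighbours gives a nonzero uncoloured stress, which sparsity
forbids. -/

noncomputable section

namespace SphereRigidity

open scoped Classical
open Matrix Module

/-! ### Generic points and semicontinuity of rank -/

section Generic

/-- If every rational polynomial vanishing at `x` also vanishes at `y`, then evaluating a matrix of
rational polynomials at `y` does not give a larger rank than evaluating it at `x`. -/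
theorem rank_map_aeval_le {σ m n : Type*} [Fintype m] [Fintype n]
    (M : Matrix m n (MvPolynomial σ ℚ)) (x y : σ → ℝ)
    (h : ∀ f : MvPolynomial σ ℚ, MvPolynomial.aeval x f = 0 → MvPolynomial.aeval y f = 0) :
    (M.map (MvPolynomial.aeval y)).rank ≤ (M.map (MvPolynomial.aeval x)).rank := by
  set My := M.map (MvPolynomial.aeval y : MvPolynomial σ ℚ →ₐ[ℚ] ℝ) with hMy
  obtain ⟨f, hf, -, hlin⟩ := Submodule.exists_fun_fin_finrank_span_eq ℝ (Set.range My.row)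
  choose g hg using hf
  have hlin' : LinearIndependent ℝ (My.submatrix g id).row := by
    have heq : (My.submatrix g id).row = f := funext hg
    rw [heq]
    exact hlin
  have hrank := hlin'.rank_matrix
  rw [← rank_self_mul_transpose, rank_eq_finrank_span_row] at hrank
  -- Over `ℝ` a matrix and its Gram matrix have equal rank, so the independence of the chosen rows
  -- is witnessed by one polynomial, the Gram determinant.
  have hgram : LinearIndependent ℝ (My.submatrix g id * (My.submatrix g id)ᵀ).row :=
    linearIndependent_iff_card_eq_finrank_span.mpr hrank.symm
  have hdet := ((Matrix.isUnit_iff_isUnit_det _).1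
    (linearIndependent_rows_iff_isUnit.1 hgram)).ne_zero
  have key (z : σ → ℝ) : MvPolynomial.aeval z (M.submatrix g id * (M.submatrix g id)ᵀ).det =
      ((M.map (MvPolynomial.aeval z : MvPolynomial σ ℚ →ₐ[ℚ] ℝ)).submatrix g id *
        ((M.map (MvPolynomial.aeval z : MvPolynomial σ ℚ →ₐ[ℚ] ℝ)).submatrix g id)ᵀ).det := by
    rw [AlgHom.map_det]
    congr 1
    ext i j
    simp [Matrix.mul_apply]
  rw [← key] at hdet
  have hx := mt (h _) hdet
  rw [key] at hx
  have hr := rank_of_det_ne_zero hx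
  rw [rank_self_mul_transpose, Fintype.card_fin] at hr
  rw [rank_eq_finrank_span_row, ← hr, rank_eq_finrank_span_row, rank_eq_finrank_span_row]
  apply Submodule.finrank_mono
  apply Submodule.span_mono
  rintro _ ⟨i, rfl⟩
  exact ⟨g i, rfl⟩

variable {V C : Type*}

/-- `p` is a framework on the spheres whose radii are given by `r`, up to sign. -/
def OnSpheres (χ : V → Option C) (r : C → ℝ) (p : V → Fin 3 → ℝ) : Prop :=
  ∀ v, ∑ i : Fin 3, p v i ^ 2 = ((χ v).elim 1 r) ^ 2

/-- `(p, r)` is a generic point of the variety of frameworks on concentric spheres. -/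
def GenericOnSpheres (χ : V → Option C) (r : C → ℝ) (p : V → Fin 3 → ℝ) : Prop :=
  ∀ f : MvPolynomial ((V × Fin 3) ⊕ C) ℚ,
    MvPolynomial.aeval (Sum.elim (fun x : V × Fin 3 => p x.1 x.2) r) f = 0 →
      ∀ r' p', OnSpheres χ r' p' →
        MvPolynomial.aeval (Sum.elim (fun x : V × Fin 3 => p' x.1 x.2) r') f = 0

/-- An equality of two radii would be a rational polynomial identity holding on every framework, yet
the radii of different colours can be chosen freely, and differently from the fixed radius 1. -/
theorem GenericOnSpheres.radius_ne {χ : V → Option C} {r : C → ℝ}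
    {p : V → Fin 3 → ℝ} (hp : GenericOnSpheres χ r p) {v w : V} (h : χ v ≠ χ w) :
    (χ v).elim 1 r ≠ (χ w).elim 1 r := by
  have key (f : MvPolynomial ((V × Fin 3) ⊕ C) ℚ) (r' : C → ℝ)
      (hf : MvPolynomial.aeval (Sum.elim (fun x : V × Fin 3 => p x.1 x.2) r) f = 0) :
      MvPolynomial.aeval (Sum.elim
        (fun x : V × Fin 3 => (Pi.single 0 ((χ x.1).elim 1 r') : Fin 3 → ℝ) x.2) r') f = 0 := by
    refine hp f hf r' (fun v => Pi.single 0 ((χ v).elim 1 r')) fun v => ?_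
    simp [Fin.sum_univ_three]
  intro heq
  rcases hv : χ v with _ | c <;> rcases hw : χ w with _ | d <;> rw [hv, hw] at heq h
  · exact h rfl
  · have := key (1 - MvPolynomial.X (Sum.inr d)) (fun _ => 2) (by simpa [sub_eq_zero] using heq)
    norm_num at this
  · have := key (1 - MvPolynomial.X (Sum.inr c)) (fun _ => 2)
      (by simpa [sub_eq_zero] using heq.symm)
    norm_num at this
  · have hcd : c ≠ d := fun h' => h (by rw [h'])
    have := key (MvPolynomial.X (Sum.inr c) - MvPolynomial.X (Sum.inr d))
      (fun x => if x = c then 2 else 1) (by simpa [sub_eq_zero] using heq)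
    simp [hcd.symm] at this
    norm_num at this

/-! ### Stresses and colour sums -/

variable [Fintype V]

/-- The symmetric matrices `A` with `A p = 0` whose off-diagonal entries are supported on the edges
of `H`: up to a change of sign, the equilibrium stresses of the cone over the framework `(H, p)`. -/
def stressSpace (H : SimpleGraph V) (p : V → Fin 3 → ℝ) : Submodule ℝ (V → V → ℝ) where
  carrier := {A | (∀ v w, A v w = A w v) ∧ (∀ v w, v ≠ w → ¬ H.Adj v w → A v w = 0) ∧
    ∀ v i, ∑ w, A v w * p w i = 0}
  add_mem' := by
    rintro A B ⟨h1, h2, h3⟩ ⟨g1, g2, g3⟩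
    refine ⟨fun v w => by simp [h1 v w, g1 v w], fun v w h h' => by simp [h2 v w h h', g2 v w h h'],
      fun v i => by simp [add_mul, Finset.sum_add_distrib, h3, g3]⟩
  zero_mem' := by simp
  smul_mem' := by
    rintro c A ⟨h1, h2, h3⟩
    refine ⟨fun v w => by simp [h1 v w], fun v w h h' => by simp [h2 v w h h'],
      fun v i => by simp [mul_assoc, ← Finset.mul_sum, h3]⟩

/-- The sum of the rows of `A` that belong to vertices of colour `c`. -/
def colourSum (χ : V → Option C) (c : C) : (V → V → ℝ) →ₗ[ℝ] ℝ where
  toFun A := ∑ v, if χ v = some c then ∑ w, A v w else 0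
  map_add' A B := by
    rw [← Finset.sum_add_distrib]
    refine Finset.sum_congr rfl fun v _ => ?_
    split_ifs <;> simp [Finset.sum_add_distrib]
  map_smul' a A := by
    simp only [RingHom.id_apply, smul_eq_mul, Finset.mul_sum]
    refine Finset.sum_congr rfl fun v _ => ?_
    split_ifs <;> simp [Finset.mul_sum]

theorem colourSum_apply (χ : V → Option C) (c : C) (A : V → V → ℝ) :
    colourSum χ c A = ∑ v, if χ v = some c then ∑ w, A v w else 0 := rfl

/-- The stresses whose colour sums vanish for the colours in `D`. -/
def colourStress (χ : V → Option C) (H : SimpleGraph V) (p : V → Fin 3 → ℝ) (D : Set C) :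
    Submodule ℝ (V → V → ℝ) :=
  stressSpace H p ⊓ ⨅ c ∈ D, LinearMap.ker (colourSum χ c)

theorem mem_colourStress {χ : V → Option C} {H : SimpleGraph V} {p : V → Fin 3 → ℝ} {D : Set C}
    {A : V → V → ℝ} :
    A ∈ colourStress χ H p D ↔ A ∈ stressSpace H p ∧ ∀ c ∈ D, colourSum χ c A = 0 := by
  simp [colourStress]

theorem colourStress_empty (χ : V → Option C) (H : SimpleGraph V) (p : V → Fin 3 → ℝ) :
    colourStress χ H p ∅ = stressSpace H p := by
  simp [colourStress]

/-- The linear system defining `colourStress`, over the polynomial ring in the coordinates. -/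
def stressSystem (χ : V → Option C) (H : SimpleGraph V) (D : Set C) :
    Matrix ((V × V) ⊕ (V × V) ⊕ (V × Fin 3) ⊕ C) (V × V)
      (MvPolynomial ((V × Fin 3) ⊕ C) ℚ)
  | .inl x, y => (if x = y then 1 else 0) - if x = y.swap then 1 else 0
  | .inr (.inl x), y => if x = y ∧ x.1 ≠ x.2 ∧ ¬ H.Adj x.1 x.2 then 1 else 0
  | .inr (.inr (.inl (v, i))), y => if y.1 = v then MvPolynomial.X (Sum.inl (y.2, i)) else 0
  | .inr (.inr (.inr c)), y => if c ∈ D ∧ χ y.1 = some c then 1 else 0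

theorem mem_colourStress_iff_mulVec [Fintype C] (χ : V → Option C) (H : SimpleGraph V)
    (r : C → ℝ) (p : V → Fin 3 → ℝ) (D : Set C) (a : V × V → ℝ) :
    (fun v w => a (v, w)) ∈ colourStress χ H p D ↔
      ((stressSystem χ H D).map (MvPolynomial.aeval
        (Sum.elim (fun x : V × Fin 3 => p x.1 x.2) r))) *ᵥ a = 0 := by
  rw [mem_colourStress, funext_iff]
  simp only [Sum.forall, Prod.forall]
  have e1 (v w : V) : (((stressSystem χ H D).map (MvPolynomial.aeval
        (Sum.elim (fun x : V × Fin 3 => p x.1 x.2) r))) *ᵥ a) (.inl (v, w)) =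
        a (v, w) - a (w, v) := by
    have (x : V × V) : ((v, w) = x.swap) = ((w, v) = x) := by
      rcases x with ⟨x, y⟩; simp [and_comm]
    have h' (x : V × V) : MvPolynomial.aeval (Sum.elim (fun x : V × Fin 3 => p x.1 x.2) r)
        (stressSystem χ H D (.inl (v, w)) x) * a x =
        (if (v, w) = x then a x else 0) - if (w, v) = x then a x else 0 := by
      simp only [stressSystem, this]
      split_ifs <;> simp
    simp only [Matrix.mulVec, dotProduct, Matrix.map_apply, h', Finset.sum_sub_distrib]
    simp
  have e2 (v w : V) : (((stressSystem χ H D).map (MvPolynomial.aeval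
        (Sum.elim (fun x : V × Fin 3 => p x.1 x.2) r))) *ᵥ a) (.inr (.inl (v, w))) =
        if v ≠ w ∧ ¬ H.Adj v w then a (v, w) else 0 := by
    by_cases h : v ≠ w ∧ ¬ H.Adj v w
    · simp [Matrix.mulVec, dotProduct, stressSystem, apply_ite, h]
    · rw [if_neg h]
      simp only [Matrix.mulVec, dotProduct, stressSystem, Matrix.map_apply]
      refine Finset.sum_eq_zero fun y _ => ?_
      rw [if_neg (fun h' => h h'.2)]
      simp
  have e3 (v : V) (i : Fin 3) : (((stressSystem χ H D).map (MvPolynomial.aeval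
        (Sum.elim (fun x : V × Fin 3 => p x.1 x.2) r))) *ᵥ a) (.inr (.inr (.inl (v, i)))) =
        ∑ w, a (v, w) * p w i := by
    simp [Matrix.mulVec, dotProduct, stressSystem, apply_ite, Fintype.sum_prod_type, mul_comm]
  have e4 (c : C) : (((stressSystem χ H D).map (MvPolynomial.aeval
        (Sum.elim (fun x : V × Fin 3 => p x.1 x.2) r))) *ᵥ a) (.inr (.inr (.inr c))) =
        if c ∈ D then colourSum χ c (fun v w => a (v, w)) else 0 := by
    by_cases h : c ∈ D
    · simp only [Matrix.mulVec, dotProduct, stressSystem, Matrix.map_apply, h, true_and, if_true,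
        Fintype.sum_prod_type, colourSum_apply]
      refine Finset.sum_congr rfl fun v _ => ?_
      split_ifs <;> simp
    · simp [Matrix.mulVec, dotProduct, stressSystem, h]
  simp only [e1, e2, e3, e4, Pi.zero_apply, sub_eq_zero]
  simp only [stressSpace, Submodule.mem_mk, AddSubmonoid.mem_mk, AddSubsemigroup.mem_mk,
    Set.mem_ofPred_eq, ite_eq_right_iff, and_imp, ne_eq, and_assoc]

/-- Rank-nullity for a system with rational polynomial coefficients; this form lets
`rank_map_aeval_le` compare stress dimensions at different frameworks. -/
theorem finrank_colourStress [Fintype C] (χ : V → Option C) (H : SimpleGraph V)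
    (r : C → ℝ) (p : V → Fin 3 → ℝ) (D : Set C) :
    finrank ℝ (colourStress χ H p D) + ((stressSystem χ H D).map (MvPolynomial.aeval
        (Sum.elim (fun x : V × Fin 3 => p x.1 x.2) r))).rank = Fintype.card (V × V) := by
  set M := (stressSystem χ H D).map (MvPolynomial.aeval
        (Sum.elim (fun x : V × Fin 3 => p x.1 x.2) r)) with hM
  have h := LinearMap.finrank_range_add_finrank_ker M.mulVecLin
  rw [finrank_fintype_fun_eq_card] at h
  rw [← h, add_comm, Matrix.rank, Nat.add_left_cancel_iff]
  have : colourStress χ H p D =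
      (LinearMap.ker M.mulVecLin).map (LinearEquiv.curry ℝ ℝ V V).toLinearMap := by
    ext A
    rw [Submodule.mem_map]
    constructor
    · intro hA
      refine ⟨fun x => A x.1 x.2, ?_, rfl⟩
      rw [LinearMap.mem_ker, Matrix.mulVecLin_apply, hM, ← mem_colourStress_iff_mulVec]
      exact hA
    · rintro ⟨a, ha, rfl⟩
      rw [LinearMap.mem_ker, Matrix.mulVecLin_apply, hM, ← mem_colourStress_iff_mulVec] at ha
      exact ha
  rw [this]
  exact LinearEquiv.finrank_map_eq _ _

/-- The dimension of the space of stresses is smallest at generic points. -/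
theorem GenericOnSpheres.finrank_colourStress_le [Fintype C] {χ : V → Option C} {r : C → ℝ}
    {p : V → Fin 3 → ℝ} (hp : GenericOnSpheres χ r p) (H : SimpleGraph V) (D : Set C)
    {r' : C → ℝ} {p' : V → Fin 3 → ℝ} (hp' : OnSpheres χ r' p') :
    finrank ℝ (colourStress χ H p D) ≤ finrank ℝ (colourStress χ H p' D) := by
  have h1 := finrank_colourStress χ H r p D
  have h2 := finrank_colourStress χ H r' p' D
  have h3 := rank_map_aeval_le (stressSystem χ H D) _ _ fun f hf => hp f hf r' p' hp'
  omega

theorem GenericOnSpheres.finrank_stressSpace_le [Fintype C] {χ : V → Option C} {r : C → ℝ}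
    {p : V → Fin 3 → ℝ} (hp : GenericOnSpheres χ r p) (H : SimpleGraph V)
    {r' : C → ℝ} {p' : V → Fin 3 → ℝ} (hp' : OnSpheres χ r' p') :
    finrank ℝ (stressSpace H p) ≤ finrank ℝ (stressSpace H p') := by
  have := hp.finrank_colourStress_le H ∅ hp'
  rwa [colourStress_empty, colourStress_empty] at this

/-- At most three points of a generic framework are linearly independent. -/
theorem GenericOnSpheres.eq_zero_of_card_le_three {χ : V → Option C} {r : C → ℝ}
    {p : V → Fin 3 → ℝ} (hp : GenericOnSpheres χ r p) {s : Finset V} (hs : s.card ≤ 3)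
    {g : V → ℝ} (hg : ∀ i, ∑ w ∈ s, g w * p w i = 0) {w : V} (hw : w ∈ s) : g w = 0 := by
  obtain ⟨e⟩ : Nonempty (s ↪ Fin 3) :=
    Function.Embedding.nonempty_of_card_le (by simpa using hs)
  -- Specialise the points of `s` to distinct standard basis vectors, with all radii 1; independence
  -- there carries over to the generic framework.
  let q : V → Fin 3 → ℝ := fun v => if h : v ∈ s then Pi.single (e ⟨v, h⟩) 1 else Pi.single 0 1
  have hq : OnSpheres χ (fun _ => 1) q := by
    intro v
    have h1 : (χ v).elim (1 : ℝ) (fun _ => 1) = 1 := by cases χ v <;> rfl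
    rw [h1]
    simp only [q]
    split_ifs <;> simp [Pi.single_apply]
  let M : Matrix s (Fin 3) (MvPolynomial ((V × Fin 3) ⊕ C) ℚ) :=
    Matrix.of fun v i => MvPolynomial.X (Sum.inl (v.1, i))
  have h := rank_map_aeval_le M _ _ fun f hf => hp f hf _ _ hq
  have hlin : LinearIndependent ℝ
      (M.map (MvPolynomial.aeval (Sum.elim (fun x : V × Fin 3 => q x.1 x.2) fun _ => 1))).row := by
    have : (M.map (MvPolynomial.aeval (Sum.elim (fun x : V × Fin 3 => q x.1 x.2)
        fun _ => 1))).row = (fun i : Fin 3 => (Pi.single i 1 : Fin 3 → ℝ)) ∘ e := by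
      ext v i
      simp [M, q, Matrix.row]
    rw [this]
    exact (Pi.linearIndependent_single_one (Fin 3) ℝ).comp _ e.injective
  rw [hlin.rank_matrix] at h
  have hlin' := linearIndependent_iff_card_eq_finrank_span.mpr
    ((h.antisymm (rank_le_card_height _)).trans (rank_eq_finrank_span_row _))
  have := Fintype.linearIndependent_iff.1 hlin' (fun v => g v.1) (by
    ext i
    simp only [Matrix.row, M, Finset.sum_apply, Pi.smul_apply, smul_eq_mul, Matrix.map_apply,
      Matrix.of_apply, MvPolynomial.aeval_X, Sum.elim_inl, Pi.zero_apply]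
    rw [Finset.sum_coe_sort s (fun v => g v * p v i)]
    exact hg i) ⟨w, hw⟩
  exact this

end Generic

/-! ### Equilibrium, rescaling and counting of stresses -/

section Stress

variable {V C : Type*}

/-- The symmetric matrix with given entries on the edges of `H` and on a part of the diagonal. -/
def edgeDiagMatrix (H : SimpleGraph V) (s : Finset V) :
    ((H.edgeSet → ℝ) × (s → ℝ)) →ₗ[ℝ] (V → V → ℝ) where
  toFun x v w := if v = w then if h : v ∈ s then x.2 ⟨v, h⟩ else 0
    else if h : H.Adj v w then x.1 ⟨s(v, w), h⟩ else 0
  map_add' x y := by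
    ext v w
    simp only [Pi.add_apply, Prod.fst_add, Prod.snd_add]
    split_ifs <;> simp
  map_smul' c x := by
    ext v w
    simp only [Pi.smul_apply, Prod.smul_fst, Prod.smul_snd, RingHom.id_apply]
    split_ifs <;> simp

theorem edgeDiagMatrix_apply (H : SimpleGraph V) (s : Finset V) (x : (H.edgeSet → ℝ) × (s → ℝ))
    (v w : V) : edgeDiagMatrix H s x v w = if v = w then if h : v ∈ s then x.2 ⟨v, h⟩ else 0
    else if h : H.Adj v w then x.1 ⟨s(v, w), h⟩ else 0 := rfl

theorem edgeDiagMatrix_injective (H : SimpleGraph V) (s : Finset V) :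
    Function.Injective (edgeDiagMatrix H s) := by
  intro x y hxy
  refine Prod.ext (funext ?_) (funext ?_)
  · rintro ⟨e, he⟩
    induction e using Sym2.ind with
    | _ v w =>
      have h := congrFun (congrFun hxy v) w
      have hadj : H.Adj v w := he
      simpa [edgeDiagMatrix_apply, hadj.ne, hadj] using h
  · rintro ⟨v, hv⟩
    have h := congrFun (congrFun hxy v) v
    simpa [edgeDiagMatrix_apply, hv] using h

theorem edgeDiagMatrix_symm (H : SimpleGraph V) (s : Finset V) (x : (H.edgeSet → ℝ) × (s → ℝ))
    (v w : V) : edgeDiagMatrix H s x v w = edgeDiagMatrix H s x w v := by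
  simp only [edgeDiagMatrix_apply]
  by_cases h : v = w
  · subst h; rfl
  · rw [if_neg h, if_neg (Ne.symm h)]
    by_cases hadj : H.Adj v w
    · rw [dif_pos hadj, dif_pos hadj.symm]
      exact congrArg x.1 (Subtype.ext Sym2.eq_swap)
    · rw [dif_neg hadj, dif_neg fun h' => hadj h'.symm]

/-- The torques of forces applied at the points of `s`. -/
def torque (s : Finset V) (p : V → Fin 3 → ℝ) : (s → Fin 3 → ℝ) →ₗ[ℝ] (Fin 3 → ℝ) :=
  ∑ v : s, (crossProduct.flip (p v)).comp (LinearMap.proj v)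

theorem torque_apply (s : Finset V) (p : V → Fin 3 → ℝ) (y : s → Fin 3 → ℝ) :
    torque s p y = ∑ v : s, crossProduct (y v) (p v) := by
  simp [torque]

/-- A functional `z` that kills all torques is parallel to every point of `s`, which is impossible
for `z ≠ 0` when two of the points are independent. -/
theorem torque_surjective {s : Finset V} {p : V → Fin 3 → ℝ} {u w : V} (hu : u ∈ s) (hw : w ∈ s)
    (h : ∀ a b : ℝ, (∀ i, a * p u i + b * p w i = 0) → a = 0 ∧ b = 0) :
    Function.Surjective (torque s p) := by
  rw [← LinearMap.range_eq_top]
  by_contra hne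
  obtain ⟨f, hf, hle⟩ := Submodule.exists_le_ker_of_lt_top _ (lt_top_iff_ne_top.2 hne)
  obtain ⟨z, hz⟩ : ∃ z : Fin 3 → ℝ, ∀ x, f x = z ⬝ᵥ x := by
    refine ⟨fun i => f (Pi.single i 1), fun x => ?_⟩
    rw [LinearMap.pi_apply_eq_sum_univ f x, dotProduct]
    refine Finset.sum_congr rfl fun i _ => ?_
    have : (fun j => if i = j then (1 : ℝ) else 0) = Pi.single i 1 := by
      ext j; simp [Pi.single_apply, eq_comm]
    rw [this, smul_eq_mul, mul_comm]
  have hcross (v : V) (hv : v ∈ s) (i j : Fin 3) : z i * p v j = p v i * z j := by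
    have h1 (y : Fin 3 → ℝ) : z ⬝ᵥ crossProduct y (p v) = 0 := by
      rw [← hz]
      have : crossProduct y (p v) = torque s p (Pi.single ⟨v, hv⟩ y) := by
        rw [torque_apply, Finset.sum_eq_single ⟨v, hv⟩]
        · simp
        · intro b _ hb
          simp [hb]
        · simp
      rw [this]
      exact hle ⟨_, rfl⟩
    have e0 := h1 ![1, 0, 0]
    have e1 := h1 ![0, 1, 0]
    have e2 := h1 ![0, 0, 1]
    simp [cross_apply, dotProduct, Fin.sum_univ_three] at e0 e1 e2
    fin_cases i <;> fin_cases j <;> simp <;> linarith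
  refine hf (LinearMap.ext fun x => ?_)
  rw [hz]
  have hz0 : z = 0 := by
    ext k
    by_contra hk
    simp only [Pi.zero_apply] at hk
    -- As `p u` and `p w` are both parallel to `z` and `z k ≠ 0`, their `k`-th coordinates give a
    -- linear relation between them.
    have h2 := h (p w k) (-p u k) fun i => by
      have a1 := hcross u hu k i
      have a2 := hcross w hw k i
      apply mul_left_cancel₀ hk
      linear_combination p w k * a1 - p u k * a2
    have h3 := h 1 0 fun i => by
      have a1 := hcross u hu k i
      rw [neg_eq_zero.1 h2.2] at a1
      have : p u i = 0 := by
        apply mul_left_cancel₀ hk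
        linear_combination a1
      linarith
    exact one_ne_zero h3.1
  simp [hz0]

variable [Fintype V]

theorem stressSpace_mono {H K : SimpleGraph V} (h : H ≤ K) (p : V → Fin 3 → ℝ) :
    stressSpace H p ≤ stressSpace K p :=
  fun _ ⟨h1, h2, h3⟩ => ⟨h1, fun v w hvw hK => h2 v w hvw fun hH => hK (h hH), h3⟩

/-- Rescaling the points of a framework rescales its stresses. -/
theorem smul_mem_stressSpace {H : SimpleGraph V} {p : V → Fin 3 → ℝ} {A : V → V → ℝ}
    {d e : V → ℝ} (hde : ∀ v, d v * e v = 1) (hA : A ∈ stressSpace H p) :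
    (fun v w => d v * A v w * d w) ∈ stressSpace H (fun v i => e v * p v i) := by
  obtain ⟨h1, h2, h3⟩ := hA
  refine ⟨fun v w => by simp only [h1 v w]; ring, fun v w hvw hH => by simp [h2 v w hvw hH],
    fun v i => ?_⟩
  have (w : V) : d v * A v w * d w * (e w * p w i) = d v * (A v w * p w i) := by
    linear_combination (d v * A v w * p w i) * hde w
  simp only [this, ← Finset.mul_sum, h3, mul_zero]

theorem finrank_stressSpace_smul_le (H : SimpleGraph V) (p : V → Fin 3 → ℝ)
    {d e : V → ℝ} (hde : ∀ v, d v * e v = 1) :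
    finrank ℝ (stressSpace H p) ≤ finrank ℝ (stressSpace H (fun v i => e v * p v i)) := by
  let f : stressSpace H p →ₗ[ℝ] stressSpace H (fun v i => e v * p v i) :=
    { toFun := fun A => ⟨fun v w => d v * A.1 v w * d w, smul_mem_stressSpace hde A.2⟩
      map_add' := fun A B => by ext v w; simp; ring
      map_smul' := fun c A => by ext v w; simp; ring }
  refine LinearMap.finrank_le_finrank_of_injective (f := f) fun A B hAB => ?_
  ext v w
  have hv : d v ≠ 0 := left_ne_zero_of_mul_eq_one (hde v)
  have hw : d w ≠ 0 := left_ne_zero_of_mul_eq_one (hde w)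
  have : d v * A.1 v w * d w = d v * B.1 v w * d w := congrFun (congrFun (congrArg (·.1) hAB) v) w
  exact mul_left_cancel₀ hv (mul_right_cancel₀ hw this)

theorem finrank_stressSpace_smul (H : SimpleGraph V) (p : V → Fin 3 → ℝ)
    {e : V → ℝ} (he : ∀ v, e v ≠ 0) :
    finrank ℝ (stressSpace H (fun v i => e v * p v i)) = finrank ℝ (stressSpace H p) := by
  refine le_antisymm ?_ (finrank_stressSpace_smul_le H p (d := fun v => (e v)⁻¹)
    fun v => inv_mul_cancel₀ (he v))
  refine (finrank_stressSpace_smul_le H _ (d := e) (e := fun v => (e v)⁻¹)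
    fun v => mul_inv_cancel₀ (he v)).trans_eq ?_
  have : (fun (v : V) (i : Fin 3) => (e v)⁻¹ * (e v * p v i)) = p := by
    ext v i
    rw [inv_mul_cancel_left₀ (he v)]
  rw [this]

/-- If the colour sum of `c` vanishes on all stresses of a generic framework, then the stresses
vanish on the edges that touch `c`: otherwise replace some of the points by their antipodes. -/
theorem GenericOnSpheres.eq_zero_of_colourSum_eq_zero [Fintype C] {χ : V → Option C} {r : C → ℝ}
    {p : V → Fin 3 → ℝ} (hp : GenericOnSpheres χ r p) (hs : OnSpheres χ r p)
    {H : SimpleGraph V} {c : C} (hc : ∀ A ∈ stressSpace H p, colourSum χ c A = 0)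
    {A : V → V → ℝ} (hA : A ∈ stressSpace H p) {u w : V} (huw : u ≠ w) (hu : χ u = some c) :
    A u w = 0 := by
  -- `T σ` is the colour sum of the stress obtained from `A` when each `p v` is replaced by `σ v * p
  -- v`.
  let T : (V → ℝ) → ℝ := fun σ => ∑ a, ∑ b, (if χ a = some c then A a b else 0) * (σ a * σ b)
  have key (σ : V → ℝ) (hσ : ∀ v, σ v * σ v = 1) : T σ = 0 := by
    have hs' : OnSpheres χ r (fun v i => σ v * p v i) := by
      intro v
      rw [← hs v]
      refine Finset.sum_congr rfl fun i _ => ?_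
      rw [mul_pow, pow_two (σ v), hσ, one_mul]
    -- At `p` the colour sum imposes no condition. By semicontinuity, and since sign changes
    -- preserve the dimension of the stress space, it imposes none at the reflected framework
    -- either.
    have h0 : colourStress χ H p {c} = stressSpace H p :=
      le_antisymm inf_le_left fun B hB => mem_colourStress.2 ⟨hB, by
        rintro d rfl
        exact hc B hB⟩
    have h1 := hp.finrank_colourStress_le H {c} hs'
    rw [h0, ← finrank_stressSpace_smul H p (fun v => left_ne_zero_of_mul_eq_one (hσ v))] at h1
    have h2 := Submodule.eq_of_le_of_finrank_le
      (inf_le_left : colourStress χ H (fun v i => σ v * p v i) {c} ≤ _) h1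
    have h3 := smul_mem_stressSpace hσ hA
    rw [← h2] at h3
    refine Eq.trans ?_ ((mem_colourStress.1 h3).2 c rfl)
    rw [colourSum_apply]
    refine Finset.sum_congr rfl fun a _ => ?_
    split_ifs
    · exact Finset.sum_congr rfl fun b _ => by ring
    · simp
  -- The mixed second difference of `T` in the signs of `u` and `w` isolates the entries `A u w` and
  -- `A w u`.
  have hT : ∑ a, ∑ b, (if χ a = some c then A a b else 0) *
      ((if a = u then if b = w then 4 else 0 else 0) +
        (if a = w then if b = u then 4 else 0 else 0)) =
      T (fun _ => 1) - T (fun v => if v = u then -1 else 1) -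
        (T (fun v => if v = w then -1 else 1) -
          T (fun v => (if v = u then -1 else 1) * (if v = w then -1 else 1))) := by
    simp only [T, ← Finset.sum_sub_distrib, ← mul_sub]
    refine Finset.sum_congr rfl fun a _ => Finset.sum_congr rfl fun b _ => ?_
    congr 1
    have hcases (x : V) : x = u ∨ x = w ∨ (x ≠ u ∧ x ≠ w) := by tauto
    rcases hcases a with h1 | h1 | ⟨h1, h2⟩ <;> rcases hcases b with h3 | h3 | ⟨h3, h4⟩ <;>
      simp [*, huw.symm] <;> norm_num
  have hsum := hT.trans (b := _) (c := 0) (by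
    rw [key _ (by simp), key _ fun v => by split_ifs <;> norm_num,
      key _ fun v => by split_ifs <;> norm_num, key _ fun v => by split_ifs <;> norm_num]
    norm_num)
  simp only [mul_add, Finset.sum_add_distrib, mul_ite, mul_zero, Finset.sum_ite_eq',
    Finset.sum_ite_irrel, Finset.sum_const_zero, Finset.mem_univ, if_true] at hsum
  rw [if_pos hu, hA.1 w u] at hsum
  split_ifs at hsum <;> linarith

/-- A row of a stress is a linear relation among the points, and generic points satisfy no
nontrivial relation of length at most three. -/
theorem GenericOnSpheres.row_eq_zero {χ : V → Option C} {r : C → ℝ} {p : V → Fin 3 → ℝ}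
    (hp : GenericOnSpheres χ r p) {H : SimpleGraph V} {A : V → V → ℝ} (hA : A ∈ stressSpace H p)
    {v : V} {s : Finset V} (hs : s.card ≤ 3) (hv : v ∈ s)
    (h : ∀ w, H.Adj v w → A v w ≠ 0 → w ∈ s) (w : V) : A v w = 0 := by
  have hout (w : V) (hw : w ∉ s) : A v w = 0 := by
    by_contra hne
    refine hne (hA.2.1 v w (fun e => hw (e ▸ hv)) fun hvw => hw (h w hvw hne))
  by_cases hw : w ∈ s
  · refine hp.eq_zero_of_card_le_three hs (g := A v) (fun i => ?_) hw
    rw [← hA.2.2 v i]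
    exact Finset.sum_subset (Finset.subset_univ s) fun x _ hx => by rw [hout x hx, zero_mul]
  · exact hout w hw

theorem GenericOnSpheres.diag_eq_zero {χ : V → Option C} {r : C → ℝ} {p : V → Fin 3 → ℝ}
    (hp : GenericOnSpheres χ r p) {H : SimpleGraph V} {A : V → V → ℝ} (hA : A ∈ stressSpace H p)
    {v : V} (h : ∀ w, H.Adj v w → A v w = 0) (w : V) : A v w = 0 :=
  hp.row_eq_zero hA (s := {v}) (by simp) (by simp) (fun w hw hne => absurd (h w hw) hne) w

/-- A lower bound for the dimension of the space of stresses: the equilibrium conditions satisfy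
three linear relations. -/
theorem card_edgeSet_add_three_le {H : SimpleGraph V} {p : V → Fin 3 → ℝ} {s : Finset V}
    (hs : ∀ v w, H.Adj v w → v ∈ s) {u w : V} (hu : u ∈ s) (hw : w ∈ s)
    (h : ∀ a b : ℝ, (∀ i, a * p u i + b * p w i = 0) → a = 0 ∧ b = 0) :
    Fintype.card H.edgeSet + 3 ≤ finrank ℝ (stressSpace H p) + 2 * s.card := by
  let Ψ : ((H.edgeSet → ℝ) × (s → ℝ)) →ₗ[ℝ] (s → Fin 3 → ℝ) :=
    { toFun := fun x v i => ∑ w, edgeDiagMatrix H s x v w * p w i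
      map_add' := fun x y => by
        ext v i; simp [add_mul, Finset.sum_add_distrib]
      map_smul' := fun c x => by
        ext v i; simp [mul_assoc, Finset.mul_sum] }
  have hΨ (x) (v : s) (i : Fin 3) : Ψ x v i = ∑ w, edgeDiagMatrix H s x v w * p w i := rfl
  have hzero (x) (v w : V) (hv : v ∉ s) : edgeDiagMatrix H s x v w = 0 := by
    rw [edgeDiagMatrix_apply]
    split_ifs with h1 h2
    · rfl
    · exact absurd (hs v w h2) hv
    · rfl
  have h1 := LinearMap.finrank_range_add_finrank_ker Ψ
  have h2 := LinearMap.finrank_range_add_finrank_ker (torque s p)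
  rw [LinearMap.range_eq_top.2 (torque_surjective hu hw h), finrank_top] at h2
  have h3 : finrank ℝ (LinearMap.range Ψ) ≤ finrank ℝ (LinearMap.ker (torque s p)) := by
    apply Submodule.finrank_mono
    rintro _ ⟨x, rfl⟩
    rw [LinearMap.mem_ker, torque_apply]
    have e1 (v : s) : crossProduct (Ψ x v) (p v) =
        ∑ w, edgeDiagMatrix H s x v w • crossProduct (p w) (p v) := by
      have : Ψ x v = ∑ w, edgeDiagMatrix H s x v w • p w := by
        ext i; simp [hΨ]
      simp [this]
    simp only [e1]
    rw [Finset.sum_coe_sort s (fun v => ∑ w, edgeDiagMatrix H s x v w • crossProduct (p w) (p v)),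
      Finset.sum_subset (Finset.subset_univ s) fun v _ hv => by simp [hzero x v _ hv]]
    -- The weights are symmetric and the cross product is antisymmetric, so internal forces have
    -- total torque zero; this costs the rank of `Ψ` three dimensions.
    have e2 : ∑ v, ∑ w, edgeDiagMatrix H s x v w • crossProduct (p w) (p v) =
        -∑ v, ∑ w, edgeDiagMatrix H s x v w • crossProduct (p w) (p v) := by
      conv_lhs => rw [Finset.sum_comm]
      rw [← Finset.sum_neg_distrib]
      refine Finset.sum_congr rfl fun v _ => ?_
      rw [← Finset.sum_neg_distrib]
      refine Finset.sum_congr rfl fun w _ => ?_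
      rw [edgeDiagMatrix_symm, ← smul_neg, cross_anticomm]
    exact self_eq_neg.1 e2
  have h4 : finrank ℝ (LinearMap.ker Ψ) ≤ finrank ℝ (stressSpace H p) := by
    let f : LinearMap.ker Ψ →ₗ[ℝ] stressSpace H p :=
      LinearMap.restrict (edgeDiagMatrix H s) (p := LinearMap.ker Ψ) (q := stressSpace H p) (by
        intro x hx
        refine ⟨edgeDiagMatrix_symm H s x, fun v w hvw hadj => ?_, fun v i => ?_⟩
        · simp [edgeDiagMatrix_apply, hvw, hadj]
        · by_cases hv : v ∈ s
          · exact congrFun (congrFun (LinearMap.mem_ker.1 hx) ⟨v, hv⟩) i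
          · simp [hzero x v _ hv])
    refine LinearMap.finrank_le_finrank_of_injective (f := f) fun x y hxy => ?_
    exact Subtype.ext (edgeDiagMatrix_injective H s (congrArg (·.1) hxy))
  simp only [finrank_prod, finrank_fintype_fun_eq_card, Fintype.card_coe, finrank_pi_fintype,
    Finset.sum_const, Finset.card_univ, Fintype.card_fin, smul_eq_mul] at h1 h2
  omega

end Stress

/-! ### Special positions of a vertex of degree three -/

section Independence

variable {V C : Type*}

/-- The number of colours of the vertices that are not isolated in `H`. -/
def colourCount (χ : V → Option C) (H : SimpleGraph V) : ℕ :=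
  Set.ncard {c : C | ∃ v w, H.Adj v w ∧ χ v = some c}

theorem colourCount_mono [Finite C] (χ : V → Option C) {H K : SimpleGraph V} (h : H ≤ K) :
    colourCount χ H ≤ colourCount χ K :=
  Set.ncard_le_ncard (fun _ ⟨v, w, hvw, hc⟩ => ⟨v, w, h hvw, hc⟩) (Set.toFinite _)

theorem eq_none_of_colourCount_eq_zero [Finite C] {χ : V → Option C} {H : SimpleGraph V}
    (h : colourCount χ H = 0) {v w : V} (hvw : H.Adj v w) : χ v = none := by
  rw [colourCount, Set.ncard_eq_zero (Set.toFinite _), Set.eq_empty_iff_forall_notMem] at h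
  rcases hv : χ v with _ | c
  · rfl
  · exact absurd ⟨v, w, hvw, hv⟩ (h c)

theorem two_le_finrank {M : Type*} [AddCommGroup M] [Module ℝ M] [Module.Finite ℝ M]
    {W : Submodule ℝ M} {A N : M} (hA : A ∈ W) (hN : N ∈ W)
    (h : ∀ a b : ℝ, a • A + b • N = 0 → a = 0 ∧ b = 0) : 2 ≤ finrank ℝ W := by
  have hlin : LinearIndependent ℝ ![(⟨A, hA⟩ : W), ⟨N, hN⟩] := by
    rw [LinearIndependent.pair_iff]
    intro a b hab
    exact h a b (congrArg Subtype.val hab)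
  simpa using hlin.fintype_card_le_finrank

variable [Fintype V]

/-- `H` is sparse: the number of independent stresses of each subgraph is at most the number of its
colours. -/
def IsStressSparse (χ : V → Option C) (p : V → Fin 3 → ℝ) (H : SimpleGraph V) : Prop :=
  ∀ K ≤ H, finrank ℝ (stressSpace K p) ≤ colourCount χ K

theorem IsStressSparse.mono {χ : V → Option C} {p : V → Fin 3 → ℝ} {H K : SimpleGraph V}
    (h : IsStressSparse χ p H) (hK : K ≤ H) : IsStressSparse χ p K :=
  fun L hL => h L (hL.trans hK)

theorem colourSum_vecMulVec (χ : V → Option C) (d : C) (c : V → ℝ) :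
    colourSum χ d (fun a b => c a * c b) =
      (∑ u, if χ u = some d then c u else 0) * ∑ u, c u := by
  rw [colourSum_apply, Finset.sum_mul]
  refine Finset.sum_congr rfl fun u _ => ?_
  split_ifs
  · rw [Finset.mul_sum]
  · rw [zero_mul]

theorem GenericOnSpheres.exists_coordinates {χ : V → Option C} {r : C → ℝ} {p : V → Fin 3 → ℝ}
    (hp : GenericOnSpheres χ r p) {s : Finset V} (hs : s.card = 3) (t : Fin 3 → ℝ) :
    ∃ g : V → ℝ, (∀ w, w ∉ s → g w = 0) ∧ ∀ i, ∑ w, g w * p w i = t i := by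
  let f : (s → ℝ) →ₗ[ℝ] (Fin 3 → ℝ) := Fintype.linearCombination ℝ fun w : s => p w
  have hf (g : s → ℝ) (i : Fin 3) : f g i = ∑ w, (if h : w ∈ s then g ⟨w, h⟩ else 0) * p w i := by
    rw [← Finset.sum_subset (Finset.subset_univ s) fun w _ hw => by rw [dif_neg hw, zero_mul],
      ← Finset.sum_coe_sort]
    simp [f, Fintype.linearCombination_apply]
  have hinj : Function.Injective f := by
    rw [← LinearMap.ker_eq_bot, LinearMap.ker_eq_bot']
    intro g hg
    ext ⟨w, hw⟩
    have := hp.eq_zero_of_card_le_three hs.le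
      (g := fun w => if h : w ∈ s then g ⟨w, h⟩ else 0) (fun i => by
        rw [Finset.sum_subset (Finset.subset_univ s) fun w _ hw => by rw [dif_neg hw, zero_mul],
          ← hf, hg, Pi.zero_apply]) hw
    simpa [hw] using this
  obtain ⟨g, hg⟩ := (LinearMap.injective_iff_surjective_of_finrank_eq_finrank
    (by simp [hs])).1 hinj t
  exact ⟨fun w => if h : w ∈ s then g ⟨w, h⟩ else 0, fun w hw => dif_neg hw,
    fun i => by rw [← hf, hg]⟩

/-- Let `v` be a vertex of degree at most three, `H` dependent and `H - v` independent. Moving `v`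
to the point `∑ c w • p w` of its sphere gives a stress of `H` which differs from the rank one
matrix `-c cᵀ` by a stress `N` of a graph on the other vertices. -/
theorem GenericOnSpheres.exists_stress_of_dependent [Fintype C] {χ : V → Option C} {r : C → ℝ}
    {p : V → Fin 3 → ℝ} (hp : GenericOnSpheres χ r p) (hs : OnSpheres χ r p)
    {H : SimpleGraph V} {v : V} (hdeg : (H.neighborFinset v).card ≤ 3)
    (hdep : colourStress χ H p Set.univ ≠ ⊥)
    (hind : colourStress χ (H.deleteIncidenceSet v) p Set.univ = ⊥)
    {c : V → ℝ} (hcv : c v = -1) (hc : ∀ w, w ≠ v → ¬ H.Adj v w → c w = 0)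
    (ht : ∑ i, (∑ w ∈ Finset.univ.erase v, c w * p w i) ^ 2 = ((χ v).elim 1 r) ^ 2) :
    ∃ N : V → V → ℝ,
      (∀ K : SimpleGraph V, (∀ a b, a ≠ b → a ≠ v → b ≠ v → H.Adj a b ∨ c a * c b ≠ 0 →
        K.Adj a b) → N ∈ stressSpace K p) ∧
      (∀ a b, a ≠ b → a ≠ v → b ≠ v → ¬ H.Adj a b → N a b = c a * c b) ∧
      ∀ d, colourSum χ d N = (∑ u, if χ u = some d then c u else 0) * ∑ u, c u := by
  set t : Fin 3 → ℝ := fun i => ∑ w ∈ Finset.univ.erase v, c w * p w i with ht_def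
  set q : V → Fin 3 → ℝ := Function.update p v t with hq
  have hqv : q v = t := by simp [hq]
  have hqw (w : V) (hw : w ≠ v) : q w = p w := by simp [hq, hw]
  have hsum (f : V → ℝ) (i : Fin 3) :
      ∑ w, f w * q w i = f v * t i + ∑ w ∈ Finset.univ.erase v, f w * p w i := by
    rw [← Finset.add_sum_erase _ _ (Finset.mem_univ v), hqv]
    congr 1
    exact Finset.sum_congr rfl fun w hw => by rw [hqw w (Finset.ne_of_mem_erase hw)]
  have hsum0 (f : V → ℝ) (hf : f v = 0) (i : Fin 3) : ∑ w, f w * q w i = ∑ w, f w * p w i := by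
    rw [hsum, hf, ← Finset.add_sum_erase _ _ (Finset.mem_univ v), hf, zero_mul, zero_mul]
  have hqs : OnSpheres χ r q := by
    intro w
    by_cases hw : w = v
    · rw [hw, hqv, ← ht]
    · rw [hqw w hw]; exact hs w
  have h1 := hp.finrank_colourStress_le H Set.univ hqs
  have h2 : 0 < finrank ℝ (colourStress χ H q Set.univ) :=
    lt_of_lt_of_le (by
      rw [Nat.pos_iff_ne_zero, ne_eq, Submodule.finrank_eq_zero]
      exact hdep) h1
  have h3 : colourStress χ H q Set.univ ≠ ⊥ := fun h => by
    rw [h, finrank_bot] at h2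
    exact lt_irrefl _ h2
  obtain ⟨B, hB, hB0⟩ := Submodule.exists_mem_ne_zero_of_ne_bot h3
  obtain ⟨⟨hB1, hB2, hB3⟩, hB4⟩ := mem_colourStress.1 hB
  have hnbr (g : V → ℝ) (hg0 : ∀ w, w ≠ v → ¬ H.Adj v w → g w = 0)
      (hg : ∀ i, ∑ w ∈ Finset.univ.erase v, g w * p w i = 0) (w : V) (hw : w ≠ v) : g w = 0 := by
    by_cases hadj : H.Adj v w
    · refine hp.eq_zero_of_card_le_three hdeg (g := g) (fun i => ?_) (by simpa using hadj)
      rw [← hg i]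
      refine Finset.sum_subset (fun x hx => ?_) fun x hx hx' => ?_
      · simpa using ((H.mem_neighborFinset v x).1 hx).ne'
      · rw [hg0 x (Finset.ne_of_mem_erase hx) (by simpa using hx'), zero_mul]
    · exact hg0 w hw hadj
  -- If the diagonal entry were zero, independence of the at most three neighbours would clear the
  -- whole row of `v`, making `B` a forbidden stress of `H - v` at `p`.
  have hBvv : B v v ≠ 0 := by
    intro h0
    have hrow (w : V) : B v w = 0 := by
      by_cases hw : w = v
      · rw [hw, h0]
      · refine hnbr (B v) (fun x hx hadj => hB2 v x hx.symm hadj) (fun i => ?_) w hw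
        have := hB3 v i
        rwa [hsum, h0, zero_mul, zero_add] at this
    apply hB0
    rw [← Submodule.mem_bot ℝ, ← hind]
    refine mem_colourStress.2 ⟨⟨hB1, fun a b hab hadj => ?_, fun a i => ?_⟩, hB4⟩
    · rw [SimpleGraph.deleteIncidenceSet_adj] at hadj
      by_cases ha : a = v
      · rw [ha, hrow]
      by_cases hb : b = v
      · rw [hb, hB1, hrow]
      exact hB2 a b hab fun h => hadj ⟨h, ha, hb⟩
    · rw [← hsum0 (B a) (by rw [hB1, hrow]), hB3]
  -- Normalise so that row `v` of `e B` expresses the position of `v` through its neighbours; by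
  -- uniqueness its coefficients are the `c w`.
  set e : ℝ := -(B v v)⁻¹ with he
  have hev : e * B v v = -1 := by rw [he]; field_simp
  have hcoef (w : V) (hw : w ≠ v) : e * B v w = c w := by
    rw [← sub_eq_zero]
    refine hnbr (fun w => e * B v w - c w)
      (fun x hx hadj => by rw [hB2 v x hx.symm hadj, hc x hx hadj]; ring) (fun i => ?_) w hw
    have h3 := hB3 v i
    rw [hsum] at h3
    simp only [sub_mul, Finset.sum_sub_distrib, mul_assoc, ← Finset.mul_sum]
    change e * _ - t i = 0
    linear_combination e * h3 - t i * hev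
  have hrow (w : V) : e * B v w + c v * c w = 0 := by
    by_cases hw : w = v
    · rw [hw, hev, hcv]; norm_num
    · rw [hcoef w hw, hcv]; ring
  let N : V → V → ℝ := fun a b => e * B a b + c a * c b
  have hN (a b : V) : N a b = e * B a b + c a * c b := rfl
  have hNsymm (a b : V) : N a b = N b a := by rw [hN, hN, hB1 a b, mul_comm (c a)]
  have hNv (b : V) : N v b = 0 := hrow b
  refine ⟨N, fun K hK => ⟨hNsymm, fun a b hab hadj => ?_, fun a i => ?_⟩,
    fun a b hab ha hb hadj => by rw [hN, hB2 a b hab hadj, mul_zero, zero_add], fun d => ?_⟩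
  · by_cases ha : a = v
    · rw [ha, hNv]
    by_cases hb : b = v
    · rw [hb, hNsymm, hNv]
    by_contra hne
    refine hadj (hK a b hab ha hb ?_)
    by_contra hcon
    push Not at hcon
    exact hne (by rw [hN, hB2 a b hab hcon.1, hcon.2]; ring)
  · rw [← hsum0 (N a) (by rw [hNsymm, hNv])]
    simp only [hN, add_mul, Finset.sum_add_distrib, mul_assoc, ← Finset.mul_sum]
    rw [hB3, hsum c, hcv]
    change e * 0 + c a * (-1 * t i + t i) = 0
    ring
  · have : N = e • B + fun a b => c a * c b := by
      ext a b; simp [hN]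
    rw [this, map_add, map_smul, hB4 d (Set.mem_univ d), colourSum_vecMulVec, smul_zero, zero_add]

/-- The stress obtained by moving `v` to the line through the origin and a neighbour. -/
theorem GenericOnSpheres.exists_stress_of_collinear [Fintype C] {χ : V → Option C} {r : C → ℝ}
    {p : V → Fin 3 → ℝ} (hp : GenericOnSpheres χ r p) (hs : OnSpheres χ r p)
    {H : SimpleGraph V} {v : V} (hdeg : (H.neighborFinset v).card ≤ 3)
    (hdep : colourStress χ H p Set.univ ≠ ⊥)
    (hind : colourStress χ (H.deleteIncidenceSet v) p Set.univ = ⊥)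
    {x : V} (hx : H.Adj v x) {ρ : ℝ} (hρ : (ρ * (χ x).elim 1 r) ^ 2 = ((χ v).elim 1 r) ^ 2) :
    ∃ N ∈ stressSpace (H.deleteIncidenceSet v) p, ∀ d, colourSum χ d N =
      (ρ * (if χ x = some d then 1 else 0) - if χ v = some d then 1 else 0) * (ρ - 1) := by
  have hxv : x ≠ v := hx.ne'
  let c : V → ℝ := fun w => if w = v then -1 else if w = x then ρ else 0
  have hc (f : V → ℝ) : ∑ w, c w * f w = ρ * f x - f v := by
    rw [← Finset.add_sum_erase _ _ (Finset.mem_univ v),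
      Finset.sum_eq_single_of_mem x (by simp [hxv])]
    · simp [c, hxv]; ring
    · intro b hb hbx
      simp [c, Finset.ne_of_mem_erase hb, hbx]
  obtain ⟨N, hN, -, hd⟩ := hp.exists_stress_of_dependent hs hdeg hdep hind (c := c) (by simp [c])
    (fun w hw hadj => by
      have : w ≠ x := fun h => hadj (h ▸ hx)
      simp [c, hw, this]) (by
    have (i : Fin 3) : ∑ w ∈ Finset.univ.erase v, c w * p w i = ρ * p x i := by
      rw [Finset.sum_eq_single_of_mem x (by simp [hxv])]
      · simp [c, hxv]
      · intro b hb hbx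
        simp [c, Finset.ne_of_mem_erase hb, hbx]
    simp only [this, mul_pow, ← Finset.mul_sum]
    rw [hs x, ← hρ, mul_pow])
  refine ⟨N, hN _ fun a b hab ha hb h => ?_, fun d => ?_⟩
  · rw [SimpleGraph.deleteIncidenceSet_adj]
    refine ⟨h.resolve_right fun hne => ?_, ha, hb⟩
    by_cases hax : a = x
    · have : b ≠ x := fun h => hab (hax.trans h.symm)
      simp [c, hb, this] at hne
    · simp [c, ha, hax] at hne
  · have h1 := hc fun _ => 1
    have h2 := hc fun u => if χ u = some d then 1 else 0
    simp only [mul_ite, mul_one, mul_zero] at h1 h2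
    rw [hd, h1, h2]
    simp

/-- Place `v` at either of the two points `±ρ p x` of its sphere. If `v` and `x` are equally
coloured, the antipodal choice alone suffices. Otherwise `ρ ≠ 1` because generic radii differ, and a
combination of the two stresses cancels the colour sum of the other end. -/
theorem GenericOnSpheres.exists_stress_of_coloured [Fintype C] {χ : V → Option C} {r : C → ℝ}
    {p : V → Fin 3 → ℝ} (hp : GenericOnSpheres χ r p) (hs : OnSpheres χ r p) (hr : ∀ c, 0 < r c)
    {H : SimpleGraph V} {v : V} (hdeg : (H.neighborFinset v).card ≤ 3)
    (hdep : colourStress χ H p Set.univ ≠ ⊥)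
    (hind : colourStress χ (H.deleteIncidenceSet v) p Set.univ = ⊥)
    {x : V} (hx : H.Adj v x) {d : C} (hd : χ v = some d ∨ χ x = some d) :
    ∃ N ∈ stressSpace (H.deleteIncidenceSet v) p, colourSum χ d N ≠ 0 ∧
      ∀ d' ≠ d, colourSum χ d' N = 0 := by
  have hpos (w : V) : 0 < (χ w).elim 1 r := by
    rcases χ w with _ | c
    · exact one_pos
    · exact hr c
  set ρ : ℝ := (χ v).elim 1 r / (χ x).elim 1 r with hρ
  have hρ0 : 0 < ρ := div_pos (hpos v) (hpos x)
  have hρx : ρ * (χ x).elim 1 r = (χ v).elim 1 r := div_mul_cancel₀ _ (hpos x).ne'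
  obtain ⟨N, hN, hNd⟩ := hp.exists_stress_of_collinear hs hdeg hdep hind hx (ρ := ρ) (by rw [hρx])
  obtain ⟨M, hM, hMd⟩ := hp.exists_stress_of_collinear hs hdeg hdep hind hx (ρ := -ρ)
    (by rw [neg_mul, hρx, neg_sq])
  by_cases hsame : χ v = χ x
  · have hvd : χ v = some d := hd.elim id fun h => hsame.trans h
    refine ⟨M, hM, ?_, fun d' hd' => ?_⟩
    · rw [hMd, ← hsame, if_pos hvd]
      have : 0 < (ρ + 1) ^ 2 := by positivity
      nlinarith
    · rw [hMd, ← hsame, hvd]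
      simp [hd'.symm]
  · have hρ1 : ρ ≠ 1 := by
      intro h
      rw [h, one_mul] at hρx
      exact hp.radius_ne hsame hρx.symm
    have h2 : ρ ^ 2 - 1 ≠ 0 := by
      intro h
      have : (ρ - 1) * (ρ + 1) = 0 := by linear_combination h
      rcases mul_eq_zero.1 this with h | h
      · exact hρ1 (by linarith)
      · linarith
    rcases hd with hvd | hxd
    · have hxd : χ x ≠ some d := fun h => hsame (hvd.trans h.symm)
      refine ⟨(ρ - 1) • M - (-ρ - 1) • (-N), sub_mem (Submodule.smul_mem _ _ hM)
        (Submodule.smul_mem _ _ (neg_mem hN)), ?_, fun d' hd' => ?_⟩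
      · rw [map_sub, map_smul, map_smul, map_neg, hMd, hNd, if_pos hvd, if_neg hxd]
        have : (ρ - 1) • ((-ρ * 0 - 1) * (-ρ - 1)) - (-ρ - 1) • -((ρ * 0 - 1) * (ρ - 1)) =
          2 * (ρ ^ 2 - 1) := by simp only [smul_eq_mul]; ring
        rw [this]
        exact mul_ne_zero two_ne_zero h2
      · rw [map_sub, map_smul, map_smul, map_neg, hMd, hNd, hvd]
        simp only [Option.some.injEq, hd'.symm, if_false, smul_eq_mul]
        ring
    · have hvd : χ v ≠ some d := fun h => hsame (h.trans hxd.symm)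
      refine ⟨(ρ - 1) • M - (-ρ - 1) • N, sub_mem (Submodule.smul_mem _ _ hM)
        (Submodule.smul_mem _ _ hN), ?_, fun d' hd' => ?_⟩
      · rw [map_sub, map_smul, map_smul, hMd, hNd, if_pos hxd, if_neg hvd]
        have : (ρ - 1) • ((-ρ * 1 - 0) * (-ρ - 1)) - (-ρ - 1) • ((ρ * 1 - 0) * (ρ - 1)) =
          2 * ρ * (ρ ^ 2 - 1) := by simp only [smul_eq_mul]; ring
        rw [this]
        exact mul_ne_zero (by positivity) h2
      · rw [map_sub, map_smul, map_smul, hMd, hNd, hxd]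
        simp only [Option.some.injEq, hd'.symm, if_false, smul_eq_mul]
        ring

/-- If a sparse graph has a nowhere zero stress whose colour sums vanish, then no stress of a vertex
deleted subgraph has just one nonvanishing colour sum. -/
theorem GenericOnSpheres.false_of_colourSum_eq_zero [Fintype C] {χ : V → Option C} {r : C → ℝ}
    {p : V → Fin 3 → ℝ} (hp : GenericOnSpheres χ r p) (hs : OnSpheres χ r p)
    (hC : Fintype.card C ≤ 2) {H : SimpleGraph V} (hH : IsStressSparse χ p H)
    {A : V → V → ℝ} (hA : A ∈ colourStress χ H p Set.univ)
    (hfull : ∀ u w, H.Adj u w → A u w ≠ 0) {v x : V} (hx : H.Adj v x)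
    {N : V → V → ℝ} (hN : N ∈ stressSpace (H.deleteIncidenceSet v) p) (hN0 : N ≠ 0)
    {d : C} (hd : ∀ d' ≠ d, colourSum χ d' N = 0) : False := by
  obtain ⟨hA1, hA2⟩ := mem_colourStress.1 hA
  have hNH := stressSpace_mono (H.deleteIncidenceSet_le v) p hN
  have hNvx : N v x = 0 := hN.2.1 v x hx.ne (by simp [SimpleGraph.deleteIncidenceSet_adj])
  have hlin (a b : ℝ) (h : a • A + b • N = 0) : a = 0 ∧ b = 0 := by
    have h1 := congrFun (congrFun h v) x
    simp only [Pi.add_apply, Pi.smul_apply, hNvx, smul_eq_mul, mul_zero, add_zero,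
      Pi.zero_apply, mul_eq_zero, hfull v x hx, or_false] at h1
    rw [h1, zero_smul, zero_add, smul_eq_zero] at h
    exact ⟨h1, h.resolve_right hN0⟩
  have h2 : 2 ≤ finrank ℝ (stressSpace H p) := two_le_finrank hA1 hNH hlin
  have hle : colourCount χ H ≤ 2 :=
    (Set.ncard_le_card _).trans (by rwa [Nat.card_eq_fintype_card])
  have hdim := hH H le_rfl
  have hone : colourCount χ H ≤ 1 := by
    rw [← Set.ncard_singleton d]
    refine Set.ncard_le_ncard ?_
    rintro d' ⟨u, w, huw, hu⟩
    by_contra hne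
    -- There are at most two colours, so `A` and `N` already span all stresses of `H`, and the sum
    -- of `d'` vanishes on both.
    have hker : stressSpace H p ⊓ LinearMap.ker (colourSum χ d') = stressSpace H p := by
      refine Submodule.eq_of_le_of_finrank_le inf_le_left (hdim.trans (hle.trans ?_))
      exact two_le_finrank ⟨hA1, hA2 d' (Set.mem_univ _)⟩ ⟨hNH, hd d' hne⟩ hlin
    refine hfull u w huw (hp.eq_zero_of_colourSum_eq_zero hs (fun B hB => ?_) hA1 huw.ne hu)
    rw [← hker] at hB
    exact hB.2
  omega

end Independence

/-! ### Sparse graphs are independent -/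

section Main

variable {V C : Type*}

theorem sup_edge_edgeSet_subset (K : SimpleGraph V) (x y : V) :
    (K ⊔ SimpleGraph.edge x y).edgeSet ⊆ insert s(x, y) K.edgeSet := by
  intro e
  induction e using Sym2.ind with
  | _ a b =>
    simp only [SimpleGraph.mem_edgeSet, SimpleGraph.sup_adj, SimpleGraph.adj_edge,
      Set.mem_insert_iff]
    rintro (h | h)
    · exact Or.inr h
    · exact Or.inl h.1.symm

theorem ncard_edgeSet_deleteIncidenceSet_add_two_le [Finite V] {H : SimpleGraph V} {v x y : V}
    (hx : H.Adj v x) (hy : H.Adj v y) (hxy : x ≠ y) :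
    (H.deleteIncidenceSet v).edgeSet.ncard + 2 ≤ H.edgeSet.ncard := by
  have h (z : V) : s(v, z) ∉ (H.deleteIncidenceSet v).edgeSet := by
    simp [SimpleGraph.deleteIncidenceSet_adj]
  have hne : s(v, x) ≠ s(v, y) := by
    simp only [ne_eq, Sym2.eq_iff, true_and, not_or, not_and]
    exact ⟨hxy, fun h _ => hy.ne h⟩
  calc _ = (insert s(v, x) (insert s(v, y) (H.deleteIncidenceSet v).edgeSet)).ncard := by
        rw [Set.ncard_insert_of_notMem, Set.ncard_insert_of_notMem (h y)]
        simp [hne, SimpleGraph.deleteIncidenceSet_adj]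
    _ ≤ _ := by
        refine Set.ncard_le_ncard ?_ (Set.toFinite _)
        refine Set.insert_subset hx (Set.insert_subset hy ?_)
        exact SimpleGraph.edgeSet_mono (H.deleteIncidenceSet_le v)

variable [Fintype V]

/-- The stresses of `F` that vanish on the pair `x, y` are the kernel of one functional, and they
live on `F ⊓ K`. -/
theorem finrank_stressSpace_le_add_one {F K : SimpleGraph V} {x y : V} (hxy : x ≠ y)
    (hK : F ≤ K ⊔ SimpleGraph.edge x y) (p : V → Fin 3 → ℝ) :
    finrank ℝ (stressSpace F p) ≤ finrank ℝ (stressSpace (F ⊓ K) p) + 1 := by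
  let f : stressSpace F p →ₗ[ℝ] ℝ :=
    { toFun := fun A => A.1 x y
      map_add' := fun _ _ => rfl
      map_smul' := fun _ _ => rfl }
  have h1 := LinearMap.finrank_range_add_finrank_ker f
  have h2 : finrank ℝ (LinearMap.range f) ≤ 1 :=
    (Submodule.finrank_le _).trans_eq (finrank_self ℝ)
  have h3 : finrank ℝ (LinearMap.ker f) ≤ finrank ℝ (stressSpace (F ⊓ K) p) := by
    have hmem (A : LinearMap.ker f) : A.1.1 ∈ stressSpace (F ⊓ K) p := by
      refine ⟨A.1.2.1, fun a b hab hadj => ?_, A.1.2.2.2⟩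
      by_cases hF : F.Adj a b
      · have h4 := hK hF
        rw [SimpleGraph.sup_adj] at h4
        have h5 := h4.resolve_left fun h => hadj ⟨hF, h⟩
        have h6 : A.1.1 x y = 0 := A.2
        rw [SimpleGraph.edge_adj] at h5
        rcases h5.1 with ⟨rfl, rfl⟩ | ⟨rfl, rfl⟩
        · exact h6
        · rw [A.1.2.1, h6]
      · exact A.1.2.2.1 a b hab hF
    let g : LinearMap.ker f →ₗ[ℝ] stressSpace (F ⊓ K) p :=
      { toFun := fun A => ⟨A.1.1, hmem A⟩
        map_add' := fun _ _ => rfl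
        map_smul' := fun _ _ => rfl }
    refine LinearMap.finrank_le_finrank_of_injective (f := g) fun A B hAB => ?_
    exact Subtype.ext (Subtype.ext (congrArg (·.1) hAB))
  omega

/-- In a minimal dependent sparse graph, let `v` be an uncoloured vertex of degree three with
uncoloured neighbours. Then each pair `x, y` of its neighbours is either an edge, or the graph
obtained by adding this edge to some uncoloured subgraph has a stress that uses the edge. -/
theorem GenericOnSpheres.exists_uncoloured_stress [Fintype C] {χ : V → Option C} {r : C → ℝ}
    {p : V → Fin 3 → ℝ} (hp : GenericOnSpheres χ r p) (hs : OnSpheres χ r p)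
    (hC : Fintype.card C ≤ 2) {H : SimpleGraph V} (hH : IsStressSparse χ p H)
    (ih : ∀ K : SimpleGraph V, K.edgeSet.ncard < H.edgeSet.ncard → IsStressSparse χ p K →
      colourStress χ K p Set.univ = ⊥)
    {A : V → V → ℝ} (hA : A ∈ colourStress χ H p Set.univ)
    (hfull : ∀ u w, H.Adj u w → A u w ≠ 0) {v : V} (hdeg : (H.neighborFinset v).card ≤ 3)
    (hv : χ v = none) (hnbr : ∀ w, H.Adj v w → χ w = none) {x y : V}
    (hx : H.Adj v x) (hy : H.Adj v y) (hxy : x ≠ y) :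
    ∃ F ≤ H, (∀ a b, F.Adj a b → χ a = none) ∧
      ∃ N ∈ stressSpace (F ⊔ SimpleGraph.edge x y) p, N v v = 0 ∧ (F.Adj x y ∨ N x y = 1) := by
  by_cases hadj : H.Adj x y
  · refine ⟨SimpleGraph.edge x y, ?_, ?_, 0, zero_mem _, rfl, Or.inl ?_⟩
    · intro a b hab
      rw [SimpleGraph.edge_adj] at hab
      rcases hab.1 with ⟨rfl, rfl⟩ | ⟨rfl, rfl⟩
      · exact hadj
      · exact hadj.symm
    · intro a b hab
      rw [SimpleGraph.edge_adj] at hab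
      rcases hab.1 with ⟨rfl, rfl⟩ | ⟨rfl, rfl⟩
      · exact hnbr _ hx
      · exact hnbr _ hy
    · rw [SimpleGraph.edge_adj]
      exact ⟨Or.inl ⟨rfl, rfl⟩, hxy⟩
  set H' := H.deleteIncidenceSet v with hH'
  have hle : H' ≤ H := H.deleteIncidenceSet_le v
  have hcard : H'.edgeSet.ncard + 2 ≤ H.edgeSet.ncard :=
    ncard_edgeSet_deleteIncidenceSet_add_two_le hx hy hxy
  have hind : colourStress χ H' p Set.univ = ⊥ := ih H' (by omega) (hH.mono hle)
  have hdep : colourStress χ H p Set.univ ≠ ⊥ := by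
    intro h
    rw [h, Submodule.mem_bot] at hA
    exact hfull v x hx (by rw [hA]; rfl)
  have hxv : x ≠ v := hx.ne'
  have hyv : y ≠ v := hy.ne'
  -- The point `α (p x + p y)` lies on the unit sphere.
  obtain ⟨α, hα0, hα⟩ : ∃ α : ℝ, α ≠ 0 ∧ ∑ i, (α * p x i + α * p y i) ^ 2 = 1 := by
    have hm : 0 < ∑ i, (p x i + p y i) ^ 2 := by
      refine lt_of_le_of_ne (Finset.sum_nonneg fun i _ => sq_nonneg _) fun h0 => ?_
      rw [eq_comm, Finset.sum_eq_zero_iff_of_nonneg fun i _ => sq_nonneg _] at h0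
      have := hp.eq_zero_of_card_le_three (s := {x, y}) (Finset.card_le_two.trans (by norm_num))
        (g := fun _ => 1) (fun i => by
          rw [Finset.sum_pair hxy, one_mul, one_mul]
          exact pow_eq_zero_iff two_ne_zero |>.1 (h0 i (Finset.mem_univ i))) (w := x) (by simp)
      exact one_ne_zero this
    refine ⟨(√(∑ i, (p x i + p y i) ^ 2))⁻¹, (inv_pos.2 (Real.sqrt_pos.2 hm)).ne', ?_⟩
    simp only [← mul_add, mul_pow, ← Finset.mul_sum]
    rw [inv_pow, Real.sq_sqrt hm.le, inv_mul_cancel₀ hm.ne']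
  let c : V → ℝ := fun w => if w = v then -1 else if w = x then α else if w = y then α else 0
  obtain ⟨N, hN, hNab, hNd⟩ := hp.exists_stress_of_dependent hs hdeg hdep hind (c := c)
    (by simp [c]) (fun w hw hwv => by
      have h1 : w ≠ x := fun h => hwv (h ▸ hx)
      have h2 : w ≠ y := fun h => hwv (h ▸ hy)
      simp [c, hw, h1, h2]) (by
    have (i : Fin 3) : ∑ w ∈ Finset.univ.erase v, c w * p w i = α * p x i + α * p y i := by
      rw [← Finset.sum_subset (s₁ := {x, y})]
      · rw [Finset.sum_pair hxy]
        simp [c, hxv, hyv]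
      · intro a ha
        simp only [Finset.mem_insert, Finset.mem_singleton] at ha
        rcases ha with rfl | rfl <;> simp [hxv, hyv]
      · intro a ha ha'
        simp only [Finset.mem_insert, Finset.mem_singleton, not_or] at ha'
        simp [c, Finset.ne_of_mem_erase ha, ha'.1, ha'.2]
    simp only [this, hα, hv, Option.elim_none, one_pow])
  have hcne (a : V) (ha : a ≠ v) (h : c a ≠ 0) : a = x ∨ a = y := by
    by_contra hcon
    push Not at hcon
    simp [c, ha, hcon.1, hcon.2] at h
  have hN1 : N ∈ stressSpace (H' ⊔ SimpleGraph.edge x y) p := by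
    refine hN _ fun a b hab ha hb h => ?_
    rw [SimpleGraph.sup_adj, SimpleGraph.edge_adj, SimpleGraph.deleteIncidenceSet_adj]
    refine h.imp (fun h => ⟨h, ha, hb⟩) fun h => ⟨?_, hab⟩
    rcases hcne a ha (left_ne_zero_of_mul h) with rfl | rfl <;>
      rcases hcne b hb (right_ne_zero_of_mul h) with rfl | rfl <;> simp_all
  have hNxy : N x y ≠ 0 := by
    rw [hNab x y hxy hxv hyv hadj]
    simp [c, hxv, hyv, hxy.symm, hα0]
  -- `c` is supported on `v`, `x` and `y`, all uncoloured, so every colour sum of `N` is zero.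
  have hNker : N ∈ colourStress χ (H' ⊔ SimpleGraph.edge x y) p Set.univ := by
    refine mem_colourStress.2 ⟨hN1, fun d _ => ?_⟩
    rw [hNd d, Finset.sum_eq_zero, zero_mul]
    intro u _
    split_ifs with hu
    · by_contra hne
      have huv : u ≠ v := fun h => by rw [h, hv] at hu; cases hu
      rcases hcne u huv hne with rfl | rfl
      · rw [hnbr _ hx] at hu; cases hu
      · rw [hnbr _ hy] at hu; cases hu
    · rfl
  -- Deleting `v` loses at least two edges and adding `xy` restores one, so the induction hypothesis
  -- would make this graph independent if it were sparse.
  have hns : ¬ IsStressSparse χ p (H' ⊔ SimpleGraph.edge x y) := by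
    intro hsp
    have hlt : (H' ⊔ SimpleGraph.edge x y).edgeSet.ncard < H.edgeSet.ncard := by
      have h1 := Set.ncard_le_ncard (sup_edge_edgeSet_subset H' x y) (Set.toFinite _)
      have h2 := Set.ncard_insert_le s(x, y) H'.edgeSet
      omega
    rw [ih _ hlt hsp, Submodule.mem_bot] at hNker
    exact hNxy (by rw [hNker]; rfl)
  rw [IsStressSparse] at hns
  push Not at hns
  obtain ⟨F, hF, hFlt⟩ := hns
  have hF0 : F ⊓ H' ≤ H' := inf_le_right
  have hd1 := finrank_stressSpace_le_add_one hxy hF p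
  have hd2 := hH _ (hF0.trans hle)
  have hd3 : colourCount χ (F ⊓ H') ≤ colourCount χ F := colourCount_mono χ inf_le_left
  have hAN : A ∉ stressSpace H' p := fun h =>
    hfull v x hx (h.2.1 v x hx.ne (by simp [hH', SimpleGraph.deleteIncidenceSet_adj]))
  have hdim : finrank ℝ (stressSpace H' p) < finrank ℝ (stressSpace H p) := by
    refine Submodule.finrank_lt_finrank_of_lt (lt_of_le_of_ne (stressSpace_mono hle p) fun h => ?_)
    rw [h] at hAN
    exact hAN (mem_colourStress.1 hA).1
  have htwo : finrank ℝ (stressSpace H p) ≤ 2 :=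
    (hH H le_rfl).trans ((Set.ncard_le_card _).trans (by rwa [Nat.card_eq_fintype_card]))
  have hmono : finrank ℝ (stressSpace (F ⊓ H') p) ≤ finrank ℝ (stressSpace H' p) :=
    Submodule.finrank_mono (stressSpace_mono hF0 p)
  -- `H` has at most two independent stresses and `H - v` fewer, so `F ⊓ H'` has at most one and `F`
  -- at most two; since `F` violates sparsity, it has at most one colour.
  have hcase : colourCount χ (F ⊓ H') = 0 ∨ colourCount χ (F ⊓ H') = 1 := by omega
  rcases hcase with h0 | h1
  · have hFnone : colourCount χ F = 0 := by omega
    have hbot : stressSpace (F ⊓ H') p = ⊥ := Submodule.finrank_eq_zero.1 (by omega)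
    have hpos : stressSpace F p ≠ ⊥ := fun h => by
      rw [h, finrank_bot] at hFlt
      omega
    obtain ⟨M, hM, hM0⟩ := Submodule.exists_mem_ne_zero_of_ne_bot hpos
    have hMxy : M x y ≠ 0 := by
      intro hMxy
      refine hM0 ?_
      rw [← Submodule.mem_bot ℝ, ← hbot]
      refine ⟨hM.1, fun a b hab hnadj => ?_, hM.2.2⟩
      by_cases hFab : F.Adj a b
      · have h4 := hF hFab
        rw [SimpleGraph.sup_adj] at h4
        have h5 := h4.resolve_left fun h => hnadj ⟨hFab, h⟩
        rw [SimpleGraph.edge_adj] at h5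
        rcases h5.1 with ⟨rfl, rfl⟩ | ⟨rfl, rfl⟩
        · exact hMxy
        · rw [hM.1, hMxy]
      · exact hM.2.1 a b hab hFab
    have hFv (w : V) : ¬ F.Adj v w := by
      intro h
      have h4 := hF h
      rw [SimpleGraph.sup_adj, SimpleGraph.edge_adj, SimpleGraph.deleteIncidenceSet_adj] at h4
      rcases h4 with h4 | ⟨⟨h4, -⟩ | ⟨h4, -⟩, -⟩
      · exact h4.2.1 rfl
      · exact hxv h4.symm
      · exact hyv h4.symm
    refine ⟨F ⊓ H', hF0.trans hle, fun a b hab => eq_none_of_colourCount_eq_zero hFnone hab.1,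
      (M x y)⁻¹ • M, Submodule.smul_mem _ _ (stressSpace_mono ?_ p hM), ?_, Or.inr ?_⟩
    · intro a b hab
      rw [SimpleGraph.sup_adj]
      exact (hF hab).imp (fun h => ⟨hab, h⟩) id
    · have := hp.diag_eq_zero hM (fun w hw => absurd hw (hFv w)) v
      simp [this]
    · simp [hMxy]
  -- With exactly one colour, `F ⊓ H'` still has a nonzero stress, and only the sum of that colour
  -- can be nonzero on it.
  · exfalso
    obtain ⟨d, hd⟩ := Set.ncard_eq_one.1 h1
    have hpos : stressSpace (F ⊓ H') p ≠ ⊥ := fun h => by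
      rw [h, finrank_bot] at hd1
      omega
    obtain ⟨M, hM, hM0⟩ := Submodule.exists_mem_ne_zero_of_ne_bot hpos
    refine hp.false_of_colourSum_eq_zero hs hC hH hA hfull hx (stressSpace_mono hF0 p hM) hM0
      (d := d) fun d' hd' => ?_
    rw [colourSum_apply]
    refine Finset.sum_eq_zero fun u _ => ?_
    split_ifs with hu
    · refine Finset.sum_eq_zero fun w _ => ?_
      refine hp.diag_eq_zero hM (fun z hz => absurd ?_ hd') w
      have : d' ∈ {c : C | ∃ v w, (F ⊓ H').Adj v w ∧ χ v = some c} := ⟨u, z, hz, hu⟩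
      rwa [hd] at this
    · rfl

/-- For three pairwise distinct neighbours of `v`, the uncoloured stresses of the previous theorem
combine with the stress of a complete graph on four vertices. -/
theorem GenericOnSpheres.false_of_uncoloured_stresses [Finite C] {χ : V → Option C} {r : C → ℝ}
    {p : V → Fin 3 → ℝ} (hp : GenericOnSpheres χ r p)
    {H : SimpleGraph V} (hH : IsStressSparse χ p H) {v x y z : V}
    (hv : χ v = none) (hnbr : ∀ w, H.Adj v w → χ w = none)
    (hx : H.Adj v x) (hy : H.Adj v y) (hz : H.Adj v z) (hxy : x ≠ y) (hxz : x ≠ z) (hyz : y ≠ z)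
    (h : ∀ a b, H.Adj v a → H.Adj v b → a ≠ b →
      ∃ F ≤ H, (∀ a b, F.Adj a b → χ a = none) ∧
        ∃ N ∈ stressSpace (F ⊔ SimpleGraph.edge a b) p, N v v = 0 ∧ (F.Adj a b ∨ N a b = 1)) :
    False := by
  obtain ⟨g, hg0, hg⟩ := hp.exists_coordinates (s := {x, y, z}) (by simp [hxy, hxz, hyz]) (p v)
  have hxv := hx.ne'
  have hyv := hy.ne'
  have hzv := hz.ne'
  -- The linear relation among `p v`, `p x`, `p y`, `p z`; the matrix `c cᵀ` is the stress of the
  -- complete graph on these vertices.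
  set c : V → ℝ := fun w => g w - if w = v then 1 else 0 with hc
  have hcv : c v = -1 := by
    have : g v = 0 := hg0 v (by simp [hxv.symm, hyv.symm, hzv.symm])
    simp [hc, this]
  have hc0 (w : V) (hwv : w ≠ v) (hwx : w ≠ x) (hwy : w ≠ y) (hwz : w ≠ z) : c w = 0 := by
    simp [hc, hwv, hg0 w (by simp [hwx, hwy, hwz])]
  have hcp (i : Fin 3) : ∑ w, c w * p w i = 0 := by
    simp [hc, sub_mul, Finset.sum_sub_distrib, hg]
  obtain ⟨F₁, hF₁, hF₁χ, N₁, hN₁, hN₁v, hN₁'⟩ := h x y hx hy hxy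
  obtain ⟨F₂, hF₂, hF₂χ, N₂, hN₂, hN₂v, hN₂'⟩ := h x z hx hz hxz
  obtain ⟨F₃, hF₃, hF₃χ, N₃, hN₃, hN₃v, hN₃'⟩ := h y z hy hz hyz
  let K : SimpleGraph V := F₁ ⊔ F₂ ⊔ F₃ ⊔
    (SimpleGraph.edge v x ⊔ SimpleGraph.edge v y ⊔ SimpleGraph.edge v z)
  have hKadj (a b : V) : K.Adj a b ↔ ((F₁.Adj a b ∨ F₂.Adj a b) ∨ F₃.Adj a b) ∨
      ((SimpleGraph.edge v x).Adj a b ∨ (SimpleGraph.edge v y).Adj a b) ∨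
        (SimpleGraph.edge v z).Adj a b := Iff.rfl
  have hedge (w : V) (hw : H.Adj v w) : SimpleGraph.edge v w ≤ H := by
    intro a b hab
    rw [SimpleGraph.edge_adj] at hab
    rcases hab.1 with ⟨rfl, rfl⟩ | ⟨rfl, rfl⟩
    · exact hw
    · exact hw.symm
  have hedgeχ (w : V) (hw : H.Adj v w) (a b : V) (hab : (SimpleGraph.edge v w).Adj a b) :
      χ a = none := by
    rw [SimpleGraph.edge_adj] at hab
    rcases hab.1 with ⟨rfl, rfl⟩ | ⟨rfl, rfl⟩
    · exact hv
    · exact hnbr _ hw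
  have hKH : K ≤ H :=
    sup_le (sup_le (sup_le hF₁ hF₂) hF₃) (sup_le (sup_le (hedge x hx) (hedge y hy)) (hedge z hz))
  have hKχ : colourCount χ K = 0 := by
    rw [colourCount, Set.ncard_eq_zero (Set.toFinite _), Set.eq_empty_iff_forall_notMem]
    rintro d ⟨a, b, hab, had⟩
    have : χ a = none := by
      rcases (hKadj a b).1 hab with ((h | h) | h) | ((h | h) | h)
      exacts [hF₁χ a b h, hF₂χ a b h, hF₃χ a b h, hedgeχ x hx a b h, hedgeχ y hy a b h,
        hedgeχ z hz a b h]
    rw [this] at had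
    cases had
  have hpair {F : SimpleGraph V} {N : V → V → ℝ} {s t : V}
      (hN : N ∈ stressSpace (F ⊔ SimpleGraph.edge s t) p) (h1 : F.Adj s t ∨ N s t = 1)
      {a b : V} (hab : a ≠ b) (hF : ¬ F.Adj a b) :
      N a b = if (a = s ∧ b = t) ∨ (a = t ∧ b = s) then 1 else 0 := by
    split_ifs with hst
    · rcases hst with ⟨rfl, rfl⟩ | ⟨rfl, rfl⟩
      · exact h1.resolve_left hF
      · rw [hN.1]
        exact h1.resolve_left fun h => hF h.symm
    · refine hN.2.1 a b hab fun h => ?_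
      rw [SimpleGraph.sup_adj, SimpleGraph.edge_adj] at h
      rcases h with h | h
      · exact hF h
      · exact hst h.1
  -- The `Nᵢ` cancel the entries of `c cᵀ` at pairs of neighbours that are not edges of `K`. They
  -- vanish at `(v, v)`, so the entry `-1` there survives.
  let B : V → V → ℝ := fun a b =>
    (c x * c y) * N₁ a b + (c x * c z) * N₂ a b + (c y * c z) * N₃ a b - c a * c b
  have hB : B ∈ stressSpace K p := by
    refine ⟨fun a b => ?_, fun a b hab hadj => ?_, fun a i => ?_⟩
    · simp only [B]
      rw [hN₁.1 a b, hN₂.1 a b, hN₃.1 a b, mul_comm (c a)]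
    · rw [hKadj] at hadj
      simp only [not_or, SimpleGraph.edge_adj, not_and, not_not] at hadj
      obtain ⟨⟨⟨h1, h2⟩, h3⟩, ⟨h4, h5⟩, h6⟩ := hadj
      simp only [B]
      rw [hpair hN₁ hN₁' hab h1, hpair hN₂ hN₂' hab h2, hpair hN₃ hN₃' hab h3]
      have hcases (w : V) : w = v ∨ w = x ∨ w = y ∨ w = z ∨ c w = 0 := by
        by_contra hcon
        push Not at hcon
        exact hcon.2.2.2.2 (hc0 w hcon.1 hcon.2.1 hcon.2.2.1 hcon.2.2.2.1)
      clear_value c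
      clear hg hcp hN₁ hN₂ hN₃ hN₁' hN₂' hN₃' h1 h2 h3 hpair hKadj hKH hKχ hedge hedgeχ h
      grind
    · simp only [B, sub_mul, add_mul, Finset.sum_sub_distrib, Finset.sum_add_distrib, mul_assoc,
        ← Finset.mul_sum]
      rw [hN₁.2.2, hN₂.2.2, hN₃.2.2, hcp]
      ring
  have hBv : B v v = -1 := by
    simp only [B]
    rw [hN₁v, hN₂v, hN₃v, hcv]
    norm_num
  have hbot : stressSpace K p = ⊥ := Submodule.finrank_eq_zero.1 (by
    have := hH K hKH
    omega)
  rw [hbot, Submodule.mem_bot] at hB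
  rw [hB] at hBv
  norm_num at hBv

/-- A sparse subgraph of a generic framework with at most two colours is independent. -/
theorem GenericOnSpheres.colourStress_eq_bot [Fintype C] {χ : V → Option C} {r : C → ℝ}
    {p : V → Fin 3 → ℝ} (hp : GenericOnSpheres χ r p) (hs : OnSpheres χ r p) (hr : ∀ c, 0 < r c)
    (hC : Fintype.card C ≤ 2) {H : SimpleGraph V} (hH : IsStressSparse χ p H) :
    colourStress χ H p Set.univ = ⊥ := by
  induction hn : H.edgeSet.ncard using Nat.strong_induction_on generalizing H with
  | _ n ih =>
  have ih' (K : SimpleGraph V) (hlt : K.edgeSet.ncard < H.edgeSet.ncard)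
      (hK : IsStressSparse χ p K) : colourStress χ K p Set.univ = ⊥ := ih _ (hn ▸ hlt) hK rfl
  by_contra hdep
  obtain ⟨A, hA, hA0⟩ := Submodule.exists_mem_ne_zero_of_ne_bot hdep
  obtain ⟨hA1, hA2⟩ := mem_colourStress.1 hA
  -- By minimality: a zero entry on an edge would leave a dependency after that edge is deleted.
  have hfull (u w : V) (huw : H.Adj u w) : A u w ≠ 0 := by
    intro h0
    have hlt : (H.deleteEdges {s(u, w)}).edgeSet.ncard < H.edgeSet.ncard := by
      rw [SimpleGraph.edgeSet_deleteEdges]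
      exact Set.ncard_sdiff_singleton_lt_of_mem huw (Set.toFinite _)
    apply hA0
    rw [← Submodule.mem_bot ℝ, ← ih' _ hlt (hH.mono (H.deleteEdges_le _))]
    refine mem_colourStress.2 ⟨⟨hA1.1, fun a b hab hadj => ?_, hA1.2.2⟩, hA2⟩
    rw [SimpleGraph.deleteEdges_adj, not_and, not_not, Set.mem_singleton_iff, Sym2.eq_iff] at hadj
    by_cases h : H.Adj a b
    · rcases hadj h with ⟨rfl, rfl⟩ | ⟨rfl, rfl⟩
      · exact h0
      · rw [hA1.1, h0]
    · exact hA1.2.1 a b hab h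
  obtain ⟨u₀, w₀, huw₀⟩ : ∃ u w, H.Adj u w := by
    by_contra hno
    push Not at hno
    exact hA0 (funext fun u => funext fun w =>
      hp.diag_eq_zero hA1 (fun z hz => absurd hz (hno u z)) w)
  set s : Finset V := Finset.univ.filter fun v => ∃ w, H.Adj v w with hs_def
  have hmem (v w : V) (h : H.Adj v w) : v ∈ s := by simpa [hs_def] using ⟨w, h⟩
  have hdeg3 (v : V) (hv : v ∈ s) : 3 ≤ H.degree v := by
    by_contra hlt
    obtain ⟨w, hw⟩ : ∃ w, H.Adj v w := by simpa [hs_def] using hv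
    refine hfull v w hw (hp.row_eq_zero hA1 (s := insert v (H.neighborFinset v)) ?_ (by simp)
      (fun w hw _ => by simp [hw]) w)
    refine (Finset.card_insert_le _ _).trans ?_
    rw [SimpleGraph.card_neighborFinset_eq_degree]
    omega
  have htwo : finrank ℝ (stressSpace H p) ≤ 2 :=
    (hH H le_rfl).trans ((Set.ncard_le_card _).trans (by rwa [Nat.card_eq_fintype_card]))
  -- If all degrees were at least four, then `|E| ≥ 2|s|`, while at most two independent stresses
  -- force `|E| + 3 ≤ 2|s| + 2`.
  obtain ⟨v, hv, hvdeg⟩ : ∃ v ∈ s, H.degree v = 3 := by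
    by_contra hno
    push Not at hno
    have h4 (v : V) (hv : v ∈ s) : 4 ≤ H.degree v :=
      Nat.lt_of_le_of_ne (hdeg3 v hv) (Ne.symm (hno v hv))
    have h5 := card_edgeSet_add_three_le hmem (hmem _ _ huw₀) (hmem _ _ huw₀.symm) (p := p)
      fun a b hab => by
        have hg (w : V) (hw : w ∈ ({u₀, w₀} : Finset V)) :=
          hp.eq_zero_of_card_le_three (s := {u₀, w₀}) (Finset.card_le_two.trans (by norm_num))
            (g := fun w => if w = u₀ then a else b) (fun i => by
              rw [Finset.sum_pair huw₀.ne]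
              simpa [huw₀.ne'] using hab i) hw
        have h1 := hg u₀ (by simp)
        have h2 := hg w₀ (by simp)
        simp only [if_true, if_neg huw₀.ne'] at h1 h2
        exact ⟨h1, h2⟩
    have h6 := H.sum_degrees_eq_twice_card_edges
    have h7 : s.card * 4 ≤ ∑ v, H.degree v := by
      rw [← smul_eq_mul]
      exact (Finset.card_nsmul_le_sum s _ _ h4).trans
        (Finset.sum_le_sum_of_subset (Finset.subset_univ s))
    rw [← SimpleGraph.edgeFinset_card] at h5
    omega
  have hcard : (H.neighborFinset v).card = 3 := by
    rw [SimpleGraph.card_neighborFinset_eq_degree, hvdeg]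
  obtain ⟨x, y, z, hxy, hxz, hyz, hN⟩ := Finset.card_eq_three.1 hcard
  have hadj (w : V) : H.Adj v w ↔ w = x ∨ w = y ∨ w = z := by
    rw [← SimpleGraph.mem_neighborFinset, hN]; simp
  have hx : H.Adj v x := (hadj x).2 (by simp)
  have hy : H.Adj v y := (hadj y).2 (by simp)
  have hz : H.Adj v z := (hadj z).2 (by simp)
  have hind : colourStress χ (H.deleteIncidenceSet v) p Set.univ = ⊥ := by
    refine ih' _ ?_ (hH.mono (H.deleteIncidenceSet_le v))
    have := ncard_edgeSet_deleteIncidenceSet_add_two_le hx hy hxy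
    omega
  have hcol (w : V) (hw : H.Adj v w) (d : C) : ¬ (χ v = some d ∨ χ w = some d) := by
    intro hd
    obtain ⟨N, hN, hNd, hN'⟩ := hp.exists_stress_of_coloured hs hr hcard.le hdep hind hw hd
    refine hp.false_of_colourSum_eq_zero hs hC hH hA hfull hw hN ?_ hN'
    rintro rfl
    exact hNd (map_zero _)
  have hv0 : χ v = none := Option.eq_none_iff_forall_ne_some.2 fun d hd => hcol x hx d (Or.inl hd)
  have hw0 (w : V) (hw : H.Adj v w) : χ w = none :=
    Option.eq_none_iff_forall_ne_some.2 fun d hd => hcol w hw d (Or.inr hd)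
  exact hp.false_of_uncoloured_stresses hH hv0 hw0 hx hy hz hxy hxz hyz fun a b ha hb hab =>
    hp.exists_uncoloured_stress hs hC hH ih' hA hfull hcard.le hv0 hw0 ha hb hab

end Main

/-! ### From rigidity matrices to stress spaces -/

section Translation

variable {α β C : Type*} (G : Graph α β)

/-- The simple graph formed by the edges in `F`. -/
def edgeGraph (F : Finset E(G)) : SimpleGraph V(G) where
  Adj v w := v ≠ w ∧ ∃ e ∈ F, G.IsLink e v w
  symm := ⟨fun _ _ ⟨h, e, he, hl⟩ => ⟨h.symm, e, he, hl.symm⟩⟩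
  loopless := ⟨fun _ h => h.1 rfl⟩

variable {G}

theorem edgeGraph_adj {F : Finset E(G)} {v w : V(G)} :
    (edgeGraph G F).Adj v w ↔ v ≠ w ∧ ∃ e ∈ F, G.IsLink e v w := Iff.rfl

theorem edgeGraph_mono {F F' : Finset E(G)} (h : F ⊆ F') : edgeGraph G F ≤ edgeGraph G F' :=
  fun _ _ ⟨hne, e, he, hl⟩ => ⟨hne, e, h he, hl⟩

theorem isLink_ne [G.Loopless] {e : β} {v w : V(G)} (h : G.IsLink e v w) : v ≠ w :=
  fun hvw => h.ne (congrArg Subtype.val hvw)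

theorem exists_isLink (e : E(G)) : ∃ x : V(G) × V(G), G.IsLink e x.1 x.2 := by
  obtain ⟨x, y, h⟩ := Graph.exists_isLink_of_mem_edgeSet e.2
  exact ⟨(⟨x, h.left_mem⟩, ⟨y, h.right_mem⟩), h⟩

theorem numColours_eq_colourCount [G.Loopless] (χ : V(G) → Option C) (F : Finset E(G)) :
    numColours G χ F = colourCount χ (edgeGraph G F) := by
  unfold numColours colourCount
  congr 1
  ext c
  constructor
  · rintro ⟨e, he, v, ⟨y, hy⟩, hv⟩
    have hl : G.IsLink e v (⟨y, hy.right_mem⟩ : V(G)) := hy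
    exact ⟨v, ⟨y, hy.right_mem⟩, ⟨isLink_ne hl, e, he, hl⟩, hv⟩
  · rintro ⟨v, w, ⟨-, e, he, hl⟩, hv⟩
    exact ⟨e, he, v, ⟨w, hl⟩, hv⟩

theorem exists_edgeGraph_eq [G.Simple] [Fintype E(G)] {K : SimpleGraph V(G)}
    (hK : K ≤ edgeGraph G Finset.univ) : ∃ F : Finset E(G), edgeGraph G F = K := by
  refine ⟨Finset.univ.filter fun e => ∃ v w : V(G), G.IsLink e v w ∧ K.Adj v w, ?_⟩
  ext v w
  rw [edgeGraph_adj]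
  constructor
  · rintro ⟨hne, e, he, hl⟩
    obtain ⟨a, b, hab, hadj⟩ := (Finset.mem_filter.1 he).2
    rcases hab.eq_and_eq_or_eq_and_eq hl with ⟨h1, h2⟩ | ⟨h1, h2⟩
    · rwa [Subtype.ext h1, Subtype.ext h2] at hadj
    · rw [Subtype.ext h1, Subtype.ext h2] at hadj
      exact hadj.symm
  · intro h
    obtain ⟨hne, e, -, hl⟩ := hK h
    exact ⟨hne, e, Finset.mem_filter.2 ⟨Finset.mem_univ _, v, w, hl, h⟩, hl⟩

/-- The weight of the pair `v, w` if the edges carry the weights `g`. -/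
def edgeWeight [Fintype E(G)] (g : E(G) → ℝ) (v w : V(G)) : ℝ :=
  ∑ e : E(G), if G.IsLink e v w then g e else 0

theorem edgeWeight_symm [Fintype E(G)] (g : E(G) → ℝ) (v w : V(G)) :
    edgeWeight g v w = edgeWeight g w v := by
  simp only [edgeWeight, Graph.isLink_comm (x := (v : α))]

theorem edgeWeight_of_isLink [G.Simple] [Fintype E(G)] (g : E(G) → ℝ) {e : E(G)} {v w : V(G)}
    (h : G.IsLink e v w) : edgeWeight g v w = g e := by
  rw [edgeWeight, Finset.sum_eq_single e]
  · rw [if_pos h]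
  · intro f _ hf
    rw [if_neg fun hl => hf (Subtype.ext (hl.eq h))]
  · simp

theorem edgeWeight_eq_zero [Fintype E(G)] {g : E(G) → ℝ} {v w : V(G)}
    (h : ∀ e : E(G), G.IsLink e v w → g e = 0) : edgeWeight g v w = 0 := by
  refine Finset.sum_eq_zero fun e _ => ?_
  split_ifs with hl
  · exact h e hl
  · rfl

/-- The negative of the matrix `A`, as a weight function on the edges. -/
def stressOfMatrix : (V(G) → V(G) → ℝ) →ₗ[ℝ] (E(G) → ℝ) where
  toFun A e := -A (exists_isLink e).choose.1 (exists_isLink e).choose.2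
  map_add' A B := by ext e; simp; ring
  map_smul' c A := by ext e; simp

theorem stressOfMatrix_of_isLink {A : V(G) → V(G) → ℝ} (hA : ∀ v w, A v w = A w v)
    {e : E(G)} {v w : V(G)} (h : G.IsLink e v w) : stressOfMatrix A e = -A v w := by
  change -A (exists_isLink e).choose.1 (exists_isLink e).choose.2 = _
  rcases (exists_isLink e).choose_spec.eq_and_eq_or_eq_and_eq h with ⟨h1, h2⟩ | ⟨h1, h2⟩
  · rw [Subtype.ext h1, Subtype.ext h2]
  · rw [Subtype.ext h1, Subtype.ext h2, hA]

variable [Fintype V(G)]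

theorem sum_mul_rigidityMatrix [Fintype E(G)] {m : ℕ} (p : V(G) → EuclideanSpace ℝ (Fin m))
    (g : E(G) → ℝ) (v : V(G)) (i : Fin m) :
    ∑ e, g e * rigidityMatrix G p e (v, i) = ∑ w, edgeWeight g v w * (p v i - p w i) := by
  simp only [rigidityMatrix, Matrix.of_apply, edgeWeight, Finset.mul_sum, Finset.sum_mul]
  rw [Finset.sum_comm]
  refine Finset.sum_congr rfl fun w _ => Finset.sum_congr rfl fun e _ => ?_
  split_ifs <;> simp

variable [Fintype E(G)]

/-- The symmetric matrix with row sums `h` whose off-diagonal entries are the negatives of the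
weights `g`. -/
def matrixOfStress (g : E(G) → ℝ) (h : V(G) → ℝ) (v w : V(G)) : ℝ :=
  (if v = w then ∑ u, edgeWeight g v u + h v else 0) - edgeWeight g v w

theorem sum_matrixOfStress_mul (g : E(G) → ℝ) (h : V(G) → ℝ) (x : V(G) → ℝ) (v : V(G)) :
    ∑ w, matrixOfStress g h v w * x w = ∑ w, edgeWeight g v w * (x v - x w) + h v * x v := by
  simp only [matrixOfStress, sub_mul, Finset.sum_sub_distrib, ite_mul, zero_mul, mul_sub,
    Finset.sum_ite_eq, Finset.mem_univ, if_true, add_mul, Finset.sum_mul]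
  ring

theorem sum_matrixOfStress (g : E(G) → ℝ) (h : V(G) → ℝ) (v : V(G)) :
    ∑ w, matrixOfStress g h v w = h v := by
  simpa using sum_matrixOfStress_mul g h (fun _ => 1) v

theorem matrixOfStress_of_isLink [G.Simple] (g : E(G) → ℝ) (h : V(G) → ℝ) {e : E(G)} {v w : V(G)}
    (hl : G.IsLink e v w) : matrixOfStress g h v w = -g e := by
  rw [matrixOfStress, if_neg (isLink_ne hl), edgeWeight_of_isLink g hl, zero_sub]

theorem matrixOfStress_mem_stressSpace {F : Finset E(G)} {g : E(G) → ℝ} (hg : ∀ e ∉ F, g e = 0)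
    {h : V(G) → ℝ} {p : V(G) → Fin 3 → ℝ}
    (hp : ∀ v i, ∑ w, edgeWeight g v w * (p v i - p w i) + h v * p v i = 0) :
    matrixOfStress g h ∈ stressSpace (edgeGraph G F) p := by
  refine ⟨fun v w => ?_, fun v w hvw hadj => ?_, fun v i => ?_⟩
  · rw [matrixOfStress, matrixOfStress, edgeWeight_symm]
    by_cases hvw : v = w
    · rw [hvw]
    · rw [if_neg hvw, if_neg (Ne.symm hvw)]
  · rw [matrixOfStress, if_neg hvw, edgeWeight_eq_zero, sub_zero]
    intro e he
    by_contra hne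
    exact hadj ⟨hvw, e, by_contra fun h => hne (hg e h), he⟩
  · rw [sum_matrixOfStress_mul g h (fun w => p w i), hp]

/-- A stress is determined by its edge entries and its row sums, which are precisely the
coefficients of a row dependency. -/
theorem matrixOfStress_stressOfMatrix [G.Simple] {A : V(G) → V(G) → ℝ} {p : V(G) → Fin 3 → ℝ}
    (hA : A ∈ stressSpace (edgeGraph G Finset.univ) p) :
    matrixOfStress (stressOfMatrix A) (fun v => ∑ w, A v w) = A := by
  have hoff (v w : V(G)) (hvw : v ≠ w) : edgeWeight (stressOfMatrix A) v w = -A v w := by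
    by_cases hl : ∃ e, G.IsLink e v w
    · obtain ⟨e, hl⟩ := hl
      have h1 := edgeWeight_of_isLink (stressOfMatrix A) (e := ⟨e, hl.edge_mem⟩) hl
      rw [h1, stressOfMatrix_of_isLink hA.1 hl]
    · rw [edgeWeight_eq_zero fun e he => absurd ⟨e, he⟩ hl, hA.2.1 v w hvw, neg_zero]
      rintro ⟨-, e, -, he⟩
      exact hl ⟨e, he⟩
  have hdiag (v : V(G)) : edgeWeight (stressOfMatrix A) v v = 0 :=
    edgeWeight_eq_zero fun e he => absurd rfl (isLink_ne he)
  ext v w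
  rw [matrixOfStress]
  split_ifs with hvw
  · subst hvw
    rw [hdiag, sub_zero, ← Finset.add_sum_erase _ _ (Finset.mem_univ v), hdiag, zero_add,
      ← Finset.add_sum_erase _ (A v) (Finset.mem_univ v),
      Finset.sum_congr rfl fun u hu => hoff v u (Finset.ne_of_mem_erase hu).symm,
      Finset.sum_neg_distrib]
    ring
  · rw [hoff v w hvw, zero_sub, neg_neg]

theorem isIndependent_iff [G.Simple] (χ : V(G) → Option C)
    (p : V(G) → EuclideanSpace ℝ (Fin (2 + 1))) :
    IsIndependent G χ p ↔
      colourStress χ (edgeGraph G Finset.univ) (fun v i => p v i) Set.univ = ⊥ := by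
  have hrow (g : E(G) ⊕ V(G) → ℝ) : ∑ x, g x • (sphereRigidityMatrix G χ p).row x = 0 ↔
      (∀ v i, ∑ w, edgeWeight (fun e => g (.inl e)) v w * (p v i - p w i) +
        g (.inr v) * p v i = 0) ∧ ∀ c, (∑ v, if χ v = some c then g (.inr v) else 0) = 0 := by
    rw [funext_iff, Sum.forall, Prod.forall]
    refine and_congr (forall_congr' fun v => forall_congr' fun i => ?_) (forall_congr' fun c => ?_)
    · rw [← sum_mul_rigidityMatrix p (fun e => g (.inl e)) v i]
      simp [sphereRigidityMatrix, Matrix.row, Finset.sum_apply, sphereBlock]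
    · simp [sphereRigidityMatrix, Matrix.row, Finset.sum_apply, colourBlock]
  rw [IsIndependent, Fintype.linearIndependent_iff]
  constructor
  · intro hlin
    rw [eq_bot_iff]
    intro A hA
    obtain ⟨hA1, hA2⟩ := mem_colourStress.1 hA
    have hAeq := matrixOfStress_stressOfMatrix hA1
    have h0 := hlin (Sum.elim (stressOfMatrix A) fun v => ∑ w, A v w) ((hrow _).2
      ⟨fun v i => by
        have h1 := hA1.2.2 v i
        rw [← hAeq, sum_matrixOfStress_mul _ _ (fun w => p w i)] at h1
        exact h1, fun c => hA2 c (Set.mem_univ c)⟩)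
    have h1 : stressOfMatrix A = 0 := funext fun e => h0 (.inl e)
    have h2 : (fun v => ∑ w, A v w) = 0 := funext fun v => h0 (.inr v)
    rw [h1, h2] at hAeq
    rw [Submodule.mem_bot, ← hAeq]
    ext v w
    simp [matrixOfStress, edgeWeight]
  · intro hbot g hg
    obtain ⟨h1, h2⟩ := (hrow g).1 hg
    have hmem : matrixOfStress (fun e => g (.inl e)) (fun v => g (.inr v)) ∈
        colourStress χ (edgeGraph G Finset.univ) (fun v i => p v i) Set.univ := by
      refine mem_colourStress.2 ⟨matrixOfStress_mem_stressSpace (by simp) h1, fun c _ => ?_⟩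
      rw [colourSum_apply]
      simp only [sum_matrixOfStress]
      exact h2 c
    rw [hbot, Submodule.mem_bot] at hmem
    rintro (e | v)
    · obtain ⟨⟨v, w⟩, hl⟩ := exists_isLink e
      have := matrixOfStress_of_isLink (fun e => g (.inl e)) (fun v => g (.inr v)) hl
      rw [hmem] at this
      exact neg_eq_zero.1 this.symm
    · have := sum_matrixOfStress (fun e => g (.inl e)) (fun v => g (.inr v)) v
      rw [hmem] at this
      simpa using this.symm

omit [Fintype E(G)] in
-- A loop has a zero row, and parallel edges have equal rows.
theorem IsIndependent.simple {χ : V(G) → Option C} {p : V(G) → EuclideanSpace ℝ (Fin (2 + 1))}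
    (h : IsIndependent G χ p) : G.Simple where
  not_isLoopAt e x hx := by
    have hl : G.IsLink e x x := hx
    refine h.ne_zero (.inl (⟨e, hl.edge_mem⟩ : E(G))) ?_
    ext (⟨v, i⟩ | c)
    · change ∑ w : V(G), (if G.IsLink e v w then p v i - p w i else 0) = 0
      refine Finset.sum_eq_zero fun w _ => ?_
      split_ifs with hvw
      · rw [hl.isLink_iff] at hvw
        have : v = w := Subtype.ext (by rcases hvw with ⟨h1, h2⟩ | ⟨h1, h2⟩ <;> rw [← h1, ← h2])
        rw [this, sub_self]
      · rfl
    · rfl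
  eq_of_isLink e f x y he hf := by
    have := h.injective (a₁ := .inl (⟨e, he.edge_mem⟩ : E(G)))
      (a₂ := .inl (⟨f, hf.edge_mem⟩ : E(G))) (by
        ext (⟨v, i⟩ | c)
        · change ∑ w : V(G), (if G.IsLink e v w then p v i - p w i else 0) =
            ∑ w : V(G), (if G.IsLink f v w then p v i - p w i else 0)
          simp only [he.isLink_iff, hf.isLink_iff]
        · rfl)
    exact congrArg Subtype.val (Sum.inl_injective this)

/-- The cone over a framework in the plane. -/
def cone (q : V(G) → EuclideanSpace ℝ (Fin 2)) (v : V(G)) : Fin 3 → ℝ := ![q v 0, q v 1, 1]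

/-- The third coordinate of the cone is constantly 1, so stresses of the cone have zero row sums;
their edge weights are exactly the row dependencies of the planar rigidity matrix. -/
theorem finrank_stressSpace_cone_add_rank [G.Simple] (q : V(G) → EuclideanSpace ℝ (Fin 2))
    (F : Finset E(G)) :
    finrank ℝ (stressSpace (edgeGraph G F) (cone q)) +
      ((rigidityMatrix G q).submatrix (Subtype.val : F → E(G)) id).rank = F.card := by
  set M := (rigidityMatrix G q).submatrix (Subtype.val : F → E(G)) id with hM
  have h := LinearMap.finrank_range_add_finrank_ker Mᵀ.mulVecLin
  rw [finrank_fintype_fun_eq_card, Fintype.card_coe] at h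
  rw [← h, ← rank_transpose, Matrix.rank, add_comm, Nat.add_left_cancel_iff]
  let ext : (F → ℝ) → E(G) → ℝ := fun g e => if h : e ∈ F then g ⟨e, h⟩ else 0
  have hext (g : F → ℝ) (e : E(G)) (he : e ∉ F) : ext g e = 0 := dif_neg he
  have hmul (g : E(G) → ℝ) (hg : ∀ e ∉ F, g e = 0) (v : V(G)) (i : Fin 2) :
      (Mᵀ *ᵥ fun e : F => g e) (v, i) = ∑ w, edgeWeight g v w * (q v i - q w i) := by
    rw [← sum_mul_rigidityMatrix,
      ← Finset.sum_subset (Finset.subset_univ F) fun e _ he => by rw [hg e he, zero_mul],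
      ← Finset.sum_coe_sort]
    simp [Matrix.mulVec, dotProduct, hM, mul_comm]
  have hext' (g : F → ℝ) : (fun e : F => ext g e) = g := by
    ext e; simp [ext]
  have hcone (g : E(G) → ℝ) : (∀ v i, ∑ w, edgeWeight g v w * (cone q v i - cone q w i) +
      0 * cone q v i = 0) ↔ ∀ v i, ∑ w, edgeWeight g v w * (q v i - q w i) = 0 := by
    refine forall_congr' fun v => ?_
    simp [Fin.forall_fin_succ, cone]
  apply le_antisymm
  · have hrow {A : V(G) → V(G) → ℝ} (hA : A ∈ stressSpace (edgeGraph G F) (cone q)) (v : V(G)) :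
        ∑ w, A v w = 0 := by
      simpa [cone] using hA.2.2 v 2
    have hsub {A : V(G) → V(G) → ℝ} (hA : A ∈ stressSpace (edgeGraph G F) (cone q)) :
        matrixOfStress (stressOfMatrix A) 0 = A := by
      have h1 := matrixOfStress_stressOfMatrix
        (stressSpace_mono (edgeGraph_mono (Finset.subset_univ F)) _ hA)
      rwa [show (fun v => ∑ w, A v w) = 0 from funext (hrow hA)] at h1
    have hoff {A : V(G) → V(G) → ℝ} (hA : A ∈ stressSpace (edgeGraph G F) (cone q)) (e : E(G))
        (he : e ∉ F) : stressOfMatrix A e = 0 := by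
      obtain ⟨⟨v, w⟩, hl⟩ := exists_isLink e
      rw [stressOfMatrix_of_isLink hA.1 hl, hA.2.1 v w (isLink_ne hl), neg_zero]
      rintro ⟨-, f, hf, hfl⟩
      exact he (by rwa [← Subtype.ext (hfl.eq hl)])
    let f : stressSpace (edgeGraph G F) (cone q) →ₗ[ℝ] LinearMap.ker Mᵀ.mulVecLin :=
      { toFun := fun A => ⟨fun e => stressOfMatrix A.1 e, by
          rw [LinearMap.mem_ker, Matrix.mulVecLin_apply]
          ext ⟨v, i⟩
          rw [hmul _ (hoff A.2)]
          refine (hcone _).1 (fun v i => ?_) v i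
          have h1 := sum_matrixOfStress_mul (stressOfMatrix A.1) 0 (fun w => cone q w i) v
          rw [hsub A.2, A.2.2.2 v i] at h1
          exact h1.symm⟩
        map_add' := fun A B => by ext e; simp
        map_smul' := fun c A => by ext e; simp }
    refine LinearMap.finrank_le_finrank_of_injective (f := f) fun A B hAB => ?_
    have hval (e : E(G)) : stressOfMatrix A.1 e = stressOfMatrix B.1 e := by
      by_cases he : e ∈ F
      · exact congrFun (congrArg (·.1) hAB) ⟨e, he⟩
      · rw [hoff A.2 e he, hoff B.2 e he]
    exact Subtype.ext (by rw [← hsub A.2, ← hsub B.2, funext hval])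
  · have hmem (g : LinearMap.ker Mᵀ.mulVecLin) :
        matrixOfStress (ext g.1) 0 ∈ stressSpace (edgeGraph G F) (cone q) := by
      refine matrixOfStress_mem_stressSpace (hext g.1) ((hcone _).2 fun v i => ?_)
      rw [← hmul _ (hext g.1), hext']
      exact congrFun (LinearMap.mem_ker.1 g.2) (v, i)
    have hweight_add (g h : F → ℝ) (v w : V(G)) : edgeWeight (ext (g + h)) v w =
        edgeWeight (ext g) v w + edgeWeight (ext h) v w := by
      simp only [edgeWeight, ext, ← Finset.sum_add_distrib]
      refine Finset.sum_congr rfl fun e _ => ?_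
      split_ifs <;> simp
    have hweight_smul (c : ℝ) (g : F → ℝ) (v w : V(G)) : edgeWeight (ext (c • g)) v w =
        c * edgeWeight (ext g) v w := by
      simp only [edgeWeight, ext, Finset.mul_sum]
      refine Finset.sum_congr rfl fun e _ => ?_
      split_ifs <;> simp
    let f : LinearMap.ker Mᵀ.mulVecLin →ₗ[ℝ] stressSpace (edgeGraph G F) (cone q) :=
      { toFun := fun g => ⟨matrixOfStress (ext g.1) 0, hmem g⟩
        map_add' := fun g h => by
          ext v w
          simp only [matrixOfStress, Submodule.coe_add, hweight_add, Finset.sum_add_distrib,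
            Pi.add_apply, Pi.zero_apply]
          split_ifs <;> ring
        map_smul' := fun c g => by
          ext v w
          simp only [matrixOfStress, Submodule.coe_smul, hweight_smul, ← Finset.mul_sum,
            Pi.smul_apply, Pi.zero_apply, RingHom.id_apply, smul_eq_mul]
          split_ifs <;> ring }
    refine LinearMap.finrank_le_finrank_of_injective (f := f) fun g h hgh => ?_
    ext ⟨e, he⟩
    obtain ⟨⟨v, w⟩, hl⟩ := exists_isLink e
    have h1 : matrixOfStress (ext g.1) 0 v w = matrixOfStress (ext h.1) 0 v w :=
      congrFun (congrFun (congrArg (·.1) hgh) v) w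
    rw [matrixOfStress_of_isLink _ _ hl, matrixOfStress_of_isLink _ _ hl, neg_inj] at h1
    simpa [ext, he] using h1

/-- For generic frameworks on concentric spheres, the number of independent stresses of a set of
edges is its corank in the generic rigidity matroid of the plane. -/
theorem GenericOnSpheres.finrank_stressSpace_add_genericRank [G.Simple] [Fintype C]
    {χ : V(G) → Option C} {r : C → ℝ} {p : V(G) → Fin 3 → ℝ} (hp : GenericOnSpheres χ r p)
    (F : Finset E(G)) :
    finrank ℝ (stressSpace (edgeGraph G F) p) + genericRank 2 G F = F.card := by
  apply le_antisymm
  · obtain ⟨q, hq⟩ := Nat.sSup_mem (Set.range_nonempty _) (bddAbove_genericRank 2 G F)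
    have hq' : ((rigidityMatrix G q).submatrix (Subtype.val : F → E(G)) id).rank =
      genericRank 2 G F := hq
    rw [← hq', ← finrank_stressSpace_cone_add_rank q F]
    refine Nat.add_le_add_right ?_ _
    have hpos (v : V(G)) : 0 < ∑ i, cone q v i ^ 2 := by
      have h3 : cone q v 2 = 1 := rfl
      rw [Fin.sum_univ_three, h3]
      positivity
    have hm0 (v : V(G)) : (√(∑ i, cone q v i ^ 2))⁻¹ ≠ 0 :=
      inv_ne_zero (Real.sqrt_pos.2 (hpos v)).ne'
    have hs : OnSpheres χ (fun _ => 1)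
        (fun v i => (√(∑ i, cone q v i ^ 2))⁻¹ * cone q v i) := by
      intro v
      have h1 : (χ v).elim (1 : ℝ) (fun _ => 1) = 1 := by cases χ v <;> rfl
      simp only [h1, mul_pow, ← Finset.mul_sum]
      rw [inv_pow, Real.sq_sqrt (hpos v).le, inv_mul_cancel₀ (hpos v).ne', one_pow]
    rw [← finrank_stressSpace_smul (edgeGraph G F) (cone q) hm0]
    exact hp.finrank_stressSpace_le _ hs
  -- Conversely, no generic point has third coordinate zero, so `p` projects centrally to the plane
  -- at height 1.
  · have hz (v : V(G)) : p v 2 ≠ 0 := by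
      intro h0
      have := hp (MvPolynomial.X (Sum.inl (v, 2))) (by simpa using h0) (fun _ => 1)
        (fun _ => Pi.single 2 1) fun v => by
          have h1 : (χ v).elim (1 : ℝ) (fun _ => 1) = 1 := by cases χ v <;> rfl
          simp [h1, Fin.sum_univ_three]
      simp at this
    let q : V(G) → EuclideanSpace ℝ (Fin 2) :=
      fun v => WithLp.toLp 2 ![(p v 2)⁻¹ * p v 0, (p v 2)⁻¹ * p v 1]
    have hq : cone q = fun v i => (p v 2)⁻¹ * p v i := by
      ext v i
      fin_cases i
      · simp [cone, q]
      · simp [cone, q]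
      · simp [cone, inv_mul_cancel₀ (hz v)]
    rw [← finrank_stressSpace_cone_add_rank q F, hq,
      finrank_stressSpace_smul _ _ fun v => inv_ne_zero (hz v)]
    exact Nat.add_le_add_left (le_ciSup (bddAbove_genericRank 2 G F) q) _

theorem GenericOnSpheres.isSparse_iff [G.Simple] [Fintype C] {χ : V(G) → Option C} {r : C → ℝ}
    {p : V(G) → Fin 3 → ℝ} (hp : GenericOnSpheres χ r p) :
    IsSparse 2 G χ ↔ IsStressSparse χ p (edgeGraph G Finset.univ) := by
  constructor
  · intro h K hK
    obtain ⟨F, rfl⟩ := exists_edgeGraph_eq hK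
    have h1 := h F
    rw [← hp.finrank_stressSpace_add_genericRank, numColours_eq_colourCount] at h1
    omega
  · intro h F
    have h1 := h _ (edgeGraph_mono (Finset.subset_univ F))
    rw [← hp.finrank_stressSpace_add_genericRank, numColours_eq_colourCount]
    omega

omit [Fintype V(G)] [Fintype E(G)] in
theorem IsFramework.onSpheres {χ : V(G) → Option C} {r : C → ℝ}
    {p : V(G) → EuclideanSpace ℝ (Fin (2 + 1))} (h : IsFramework G χ r p) :
    OnSpheres χ r fun v i => p v i := by
  intro v
  rw [← h.2 v, EuclideanSpace.norm_sq_eq]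
  simp

omit [Fintype V(G)] [Fintype E(G)] in
-- Only this consequence of genericity is used: polynomials in the sphere ideal vanish on every
-- framework, including those with nonpositive radii.
theorem IsGeneric.genericOnSpheres {χ : V(G) → Option C} {r : C → ℝ}
    {p : V(G) → EuclideanSpace ℝ (Fin (2 + 1))} (h : IsGeneric G χ r p) :
    GenericOnSpheres χ r fun v i => p v i := by
  intro f hf r' p' hp'
  have h1 := h f hf
  have h2 : Ideal.span (Set.range (spherePolynomial 2 G χ)) ≤ RingHom.ker
      (MvPolynomial.aeval (Sum.elim (fun x : V(G) × Fin 3 => p' x.1 x.2) r') :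
        MvPolynomial ((V(G) × Fin 3) ⊕ C) ℚ →ₐ[ℚ] ℝ) := by
    rw [Ideal.span_le]
    rintro _ ⟨v, rfl⟩
    have h3 := hp' v
    rw [SetLike.mem_coe, RingHom.mem_ker, spherePolynomial, map_sub, map_sum, sub_eq_zero]
    simp only [map_pow, MvPolynomial.aeval_X, Sum.elim_inl]
    refine Eq.trans h3 ?_
    rcases χ v with _ | c <;> simp
  exact h2 h1

end Translation

/-! ### Necessity of sparsity and the final equivalence -/

/-- In an independent framework, the stresses of a graph are determined by the colour sums of the
colours of its vertices. -/
theorem GenericOnSpheres.finrank_stressSpace_le_colourCount {V C : Type*} [Fintype V] [Fintype C]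
    {χ : V → Option C} {r : C → ℝ} {p : V → Fin 3 → ℝ} (hp : GenericOnSpheres χ r p)
    {H : SimpleGraph V} (h : colourStress χ H p Set.univ = ⊥) :
    finrank ℝ (stressSpace H p) ≤ colourCount χ H := by
  set S := {c : C | ∃ v w, H.Adj v w ∧ χ v = some c} with hS
  have hcard : colourCount χ H = finrank ℝ (S → ℝ) := by
    rw [finrank_fintype_fun_eq_card, ← Nat.card_eq_fintype_card]
    rfl
  rw [hcard]
  let f : stressSpace H p →ₗ[ℝ] (S → ℝ) :=
    LinearMap.pi fun c => (colourSum χ c.1).comp (stressSpace H p).subtype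
  refine LinearMap.finrank_le_finrank_of_injective (f := f) ?_
  rw [← LinearMap.ker_eq_bot, LinearMap.ker_eq_bot']
  rintro ⟨A, hA⟩ hfA
  have hA0 : A ∈ colourStress χ H p Set.univ := by
    refine mem_colourStress.2 ⟨hA, fun c _ => ?_⟩
    by_cases hc : c ∈ S
    · exact congrFun hfA ⟨c, hc⟩
    · rw [colourSum_apply]
      refine Finset.sum_eq_zero fun v _ => ?_
      split_ifs with hv
      · exact Finset.sum_eq_zero fun w _ =>
          hp.diag_eq_zero hA (fun z hz => absurd ⟨v, z, hz, hv⟩ hc) w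
      · rfl
  rw [h, Submodule.mem_bot] at hA0
  exact Subtype.ext hA0

end SphereRigidity

end

theorem theorem2 {α β C : Type*} (G : Graph α β) [Fintype V(G)] [Fintype E(G)] [Fintype C]
    (χ : V(G) → Option C) (hχ : ∀ c : C, ∃ v : V(G), χ v = some c)
    (hk : Fintype.card C ≤ 2) (hn : Fintype.card C + 3 ≤ Fintype.card V(G))
    (r : C → ℝ) (p : V(G) → EuclideanSpace ℝ (Fin (2 + 1)))
    (hp : SphereRigidity.IsFramework G χ r p) (hgen : SphereRigidity.IsGeneric G χ r p) :
    SphereRigidity.IsIsostatic G χ p ↔ G.Simple ∧ SphereRigidity.IsTight 2 G χ := by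
  have hgen' := hgen.genericOnSpheres
  -- For independent rows the rank is `|E| + n`, and `n ≥ k + 3` makes the minimum equal to `k`, so
  -- rigidity is the edge count.
  have hrank (h : SphereRigidity.IsIndependent G χ p) :
      SphereRigidity.IsInfinitesimallyRigid G χ p ↔ (Fintype.card E(G) : ℤ) =
        (2 : ℕ) * Fintype.card V(G) - ((2 + 1).choose 2 : ℕ) + Fintype.card C := by
    have hmin : min (Fintype.card C : ℤ) (Fintype.card V(G) - ((2 : ℕ) + 1)) = Fintype.card C :=
      min_eq_left (by push_cast; omega)
    have hch : (2 + 1).choose 2 = 3 := rfl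
    rw [SphereRigidity.IsInfinitesimallyRigid, hmin, LinearIndependent.rank_matrix h,
      Fintype.card_sum, hch]
    push_cast
    constructor <;> intro h' <;> linarith
  constructor
  · rintro ⟨hind, hrig⟩
    have hsimple := hind.simple
    refine ⟨hsimple, (hrank hind).1 hrig, hgen'.isSparse_iff.2 fun K hK => ?_⟩
    rw [SphereRigidity.isIndependent_iff] at hind
    refine hgen'.finrank_stressSpace_le_colourCount ?_
    rw [eq_bot_iff, ← hind]
    exact inf_le_inf_right _ (SphereRigidity.stressSpace_mono hK _)
  · rintro ⟨hsimple, hcard, hsparse⟩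
    have hind : SphereRigidity.IsIndependent G χ p := by
      rw [SphereRigidity.isIndependent_iff]
      exact hgen'.colourStress_eq_bot hp.onSpheres hp.1 hk (hgen'.isSparse_iff.1 hsparse)
    exact ⟨hind, (hrank hind).2 hcard⟩
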